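/- An $n$-dimensional crystallographic group is a discrete cocompact subgroup $\Gamma$ of $\mathrm{Isom}(\mathbb E^n)=O(n)\ltimes\mathbb R^n$; it is a Bieberbach group if it is torsion-free. Its lattice subgroup is the subgroup $\Gamma\cap\mathbb R^n\cong\mathbb Z^n$ of translations, and its holonomy group is $G=\Gamma/(\Gamma\cap\mathbb R^n)$, which acts on the lattice subgroup by conjugation. $\Gamma$ is of diagonal type if the lattice subgroup has a $\mathbb Z$-basis $e_1,\dots,e_n$ with $g\cdot e_i=\pm e_i$ for all $g\in G$ and all $i$. For an elementary abelian $2$-group $G$, the diagonal Vasquez invariant $n_d(G)$ is the smallest integer $N$ such that, for every Bieberbach group $\Gamma$ of diagonal type (of any dimension) with holonomy group isomorphic to $G$, the lattice subgroup of $\Gamma$ contains a subgroup $M$, normal in $\Gamma$, such that $\Gamma/M$ is isomorphic to a Bieberbach group of diagonal type of dimension at most $N$. Theorem. For every integer $k\ge 2$ the invariant $n_d(C_2^k)$ exists (is finite), and $$5\cdot 2^{k-3}+1\;\ge\; n_d(C_2^k)\;\ge\;\begin{cases}\dfrac{k(k+1)}{2} & \text{if } k \text{ is even},\\[2mm] \dfrac{k(k+1)}{2}-1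 & \text{if } k \text{ is odd},\end{cases}$$ where for $k=2$ the left-hand side is the rational number $7/2$. -/

import Mathlib

/-- The isometry group `Isom(𝔼ⁿ)` of `n`-dimensional Euclidean space. -/
abbrev EuclideanIsom (n : ℕ) : Type :=
  EuclideanSpace ℝ (Fin n) ≃ᵃⁱ[ℝ] EuclideanSpace ℝ (Fin n)

/-- The identification of `Isom(𝔼ⁿ)` with `O(n) ⋉ ℝⁿ`, as a map into
`End(ℝⁿ) × ℝⁿ`: the isometry `x ↦ A x + a` is sent to the pair `(A, a)`. -/
noncomputable def EuclideanIsom.toPair {n : ℕ} (γ : EuclideanIsom n) :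
    (EuclideanSpace ℝ (Fin n) →L[ℝ] EuclideanSpace ℝ (Fin n)) × EuclideanSpace ℝ (Fin n) :=
  (γ.linearIsometryEquiv.toContinuousLinearEquiv.toContinuousLinearMap, γ 0)

/-- The topology of `O(n) ⋉ ℝⁿ` on `Isom(𝔼ⁿ)`. -/
noncomputable instance EuclideanIsom.instTopologicalSpace (n : ℕ) :
    TopologicalSpace (EuclideanIsom n) :=
  TopologicalSpace.induced EuclideanIsom.toPair inferInstance

/-- The homomorphism `Isom(𝔼ⁿ) → O(n)`, `(x ↦ A x + a) ↦ A`. -/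
noncomputable def EuclideanIsom.linearHom (n : ℕ) :
    EuclideanIsom n →* (EuclideanSpace ℝ (Fin n) ≃ₗᵢ[ℝ] EuclideanSpace ℝ (Fin n)) where
  toFun γ := γ.linearIsometryEquiv
  map_one' := rfl
  map_mul' _ _ := rfl

/-- A crystallographic group of dimension `n`: a discrete and cocompact subgroup of
`Isom(𝔼ⁿ)`. -/
structure IsCrystallographicGroup {n : ℕ} (Γ : Subgroup (EuclideanIsom n)) : Prop where
  discrete : DiscreteTopology Γ
  cocompact : ∃ K : Set (EuclideanSpace ℝ (Fin n)), IsCompact K ∧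
    ∀ x : EuclideanSpace ℝ (Fin n), ∃ γ ∈ Γ, γ x ∈ K

/-- A Bieberbach group of dimension `n`: a crystallographic group whose only element of finite
order is the identity. -/
structure IsBieberbachGroup {n : ℕ} (Γ : Subgroup (EuclideanIsom n)) : Prop where
  crystallographic : IsCrystallographicGroup Γ
  torsion_free : ∀ γ ∈ Γ, IsOfFinOrder γ → γ = 1

/-- The projection `p : Γ → O(n)`, `(A, a) ↦ A`. -/
noncomputable def holonomyHom {n : ℕ} (Γ : Subgroup (EuclideanIsom n)) :
    Γ →* (EuclideanSpace ℝ (Fin n) ≃ₗᵢ[ℝ] EuclideanSpace ℝ (Fin n)) :=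
  (EuclideanIsom.linearHom n).comp Γ.subtype

/-- The lattice subgroup `Γ ∩ ℝⁿ` of `Γ`, consisting of the translations in `Γ`. -/
noncomputable def latticeSubgroup {n : ℕ} (Γ : Subgroup (EuclideanIsom n)) : Subgroup Γ :=
  (holonomyHom Γ).ker

/-- The holonomy group of `Γ`, the quotient of `Γ` by its lattice subgroup realized as the group
of linear parts of the elements of `Γ`. -/
noncomputable def holonomyGroup {n : ℕ} (Γ : Subgroup (EuclideanIsom n)) :
    Subgroup (EuclideanSpace ℝ (Fin n) ≃ₗᵢ[ℝ] EuclideanSpace ℝ (Fin n)) :=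
  (holonomyHom Γ).range

/-- The holonomy representation of `Γ` is diagonal: there are vectors `b₁, …, bₙ` such that the
translations in `Γ` are exactly those by vectors of `ℤ b₁ ⊕ ⋯ ⊕ ℤ bₙ`, and such that every element
of the holonomy group sends each `bᵢ` to `bᵢ` or `-bᵢ`.

The conjugation action of `Γ` on its translations is given by the linear parts, so this says that
the holonomy representation `G → GLₙ(ℤ)`, written in a suitable `ℤ`-basis of the lattice subgroup,
consists of diagonal matrices.  The basis need not be orthonormal. -/
def HasDiagonalHolonomy {n : ℕ} (Γ : Subgroup (EuclideanIsom n)) : Prop :=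
  ∃ b : Module.Basis (Fin n) ℝ (EuclideanSpace ℝ (Fin n)),
    (∀ v : EuclideanSpace ℝ (Fin n),
      AffineIsometryEquiv.constVAdd ℝ (EuclideanSpace ℝ (Fin n)) v ∈ Γ ↔
        v ∈ Submodule.span ℤ (Set.range b)) ∧
    ∀ g ∈ holonomyGroup Γ, ∀ i, g (b i) = b i ∨ g (b i) = -b i

/-- `H` is (isomorphic to) a Bieberbach group of diagonal type of dimension `m`. -/
def IsDiagonalBieberbachOfDim (H : Type*) [Group H] (m : ℕ) : Prop :=
  ∃ Γ : Subgroup (EuclideanIsom m),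
    IsBieberbachGroup Γ ∧ HasDiagonalHolonomy Γ ∧ Nonempty (H ≃* Γ)

/-- The property of `N` whose least instance is the diagonal Vasquez invariant of `G`: for every
Bieberbach group `Γ` of diagonal type (of any dimension) with holonomy group isomorphic to `G`,
the lattice subgroup of `Γ` contains a normal subgroup `M` of `Γ` such that `Γ ⧸ M` is a
Bieberbach group of diagonal type of dimension at most `N`. -/
def DiagonalVasquezProperty (G : Type*) [Group G] (N : ℕ) : Prop :=
  ∀ (n : ℕ) (Γ : Subgroup (EuclideanIsom n)),
    IsBieberbachGroup Γ → HasDiagonalHolonomy Γ → Nonempty (holonomyGroup Γ ≃* G) →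
      ∃ (M : Subgroup Γ) (_ : M.Normal), M ≤ latticeSubgroup Γ ∧
        ∃ m ≤ N, IsDiagonalBieberbachOfDim (Γ ⧸ M) m

/-- The diagonal Vasquez invariant `n_d(G)`. -/
noncomputable def diagonalVasquez (G : Type*) [Group G] : ℕ :=
  sInf {N : ℕ | DiagonalVasquezProperty G N}

/-- The elementary abelian `2`-group `C₂ᵏ`, written multiplicatively. -/
abbrev ElementaryTwoGroup (k : ℕ) : Type :=
  Multiplicative (Fin k → ZMod 2)

/-! A group of diagonal type with holonomy `C₂ᵏ` is encoded, coordinate by coordinate, by pairs of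
linear forms on `𝔽₂ᵏ`: a character `χⱼ` (the sign of the holonomy) and a form `sⱼ` (the
half-translation modulo the lattice). Torsion-freeness becomes `Covers`: every nonzero `v` has some
`j` with `χⱼ(v) = 0` and `sⱼ(v) = 1`. Faithfulness of the holonomy becomes `Separates`.
`diagonalGroup` passes from forms to groups, `exists_twists` from groups to forms.

Upper bound. Projecting to a set `J` of coordinates that still covers and separates gives a
Bieberbach quotient of dimension `|J|`, so the problem is to find a small `J`. The vectors covered
by `j` form the support of the quadratic function `(1 + χⱼ)sⱼ`, and a basis of the span of these
functions already covers; the ambient space has dimension `k(k+1)/2`. Restoring separation by a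
minimal set `T` would seem to cost up to `k` more, but the products `χ_{t₀}χ_t`, for `t ≠ t₀` in
`T`, are quadratic functions independent of the chosen cover functions. Hence `|J| + |T| - 1 ≤
k(k+1)/2` when `T` is nonempty (`exists_covering_separating`). For `k ≥ 4` this is within `5·2^(k-3)
+ 1`; ranks two and three need a sharper count by hand (`exists_covering_two`,
`exists_covering_three`).

Lower bound. Let the characters be distinct and let `v` be covered by `i` alone. The square of a
lift of `v` is then the basis translation `eᵢ`. If a normal `M` with torsion-free quotient contained
a translation with nonzero `i`-th coordinate, averaging with signs over conjugates would put a
multiple of `eᵢ`, hence `eᵢ`, hence the lift of `v`, into `M`, although that lift is not a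
translation. So the coordinates with a private vector survive in the quotient and their number
bounds its dimension from below. For `k ≥ 4` the family `pairChar`, `pairShift` has `k(k+1)/2` such
coordinates, whatever the parity of `k`. -/

/-! ### Signs and half-integers -/

/-- The sign `(-1)ᵃ` of `a : ZMod 2`. -/
def zsign (a : ZMod 2) : ℤ := if a = 0 then 1 else -1

@[simp] lemma zsign_zero : zsign 0 = 1 := rfl

@[simp] lemma zsign_one : zsign 1 = -1 := rfl

lemma zsign_add (a b : ZMod 2) : zsign (a + b) = zsign a * zsign b := by
  revert a b; decide

lemma zsign_mul_self (a : ZMod 2) : zsign a * zsign a = 1 := by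
  revert a; decide

lemma zsign_injective : Function.Injective zsign := by decide

lemma zsign_cases (a : ZMod 2) : zsign a = 1 ∨ zsign a = -1 := by
  revert a; decide

lemma ZMod.two_cases (a : ZMod 2) : a = 0 ∨ a = 1 := by
  revert a; decide

/-- The representative in `{0, 1/2}` of half of a class modulo `2`. -/
noncomputable def halfRep (a : ZMod 2) : ℝ := (a.val : ℝ) / 2

@[simp] lemma halfRep_zero : halfRep 0 = 0 := by simp [halfRep]

@[simp] lemma halfRep_one : halfRep 1 = 1 / 2 := by
  simp [halfRep, show (1 : ZMod 2).val = 1 from rfl]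

lemma two_mul_halfRep (a : ZMod 2) : 2 * halfRep a = ((a.val : ℤ) : ℝ) := by
  simp only [halfRep]; push_cast; ring

/-- A sign only changes `1/2` into `-1/2`, an integral difference. Hence half-translations add
linearly modulo `ℤ` whatever the holonomy does, which makes `diagonalGroup` closed under products.
-/
lemma exists_halfRep_add (a b c : ZMod 2) :
    ∃ z : ℤ, halfRep a + zsign c * halfRep b = halfRep (a + b) + z := by
  rcases ZMod.two_cases a with rfl | rfl <;> rcases ZMod.two_cases b with rfl | rfl <;>
    rcases ZMod.two_cases c with rfl | rfl
  · exact ⟨0, by simp⟩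
  · exact ⟨0, by simp⟩
  · exact ⟨0, by simp⟩
  · exact ⟨-1, by simp; norm_num⟩
  · exact ⟨0, by simp⟩
  · exact ⟨0, by simp⟩
  · exact ⟨1, by rw [show (1 : ZMod 2) + 1 = 0 from rfl]; simp; norm_num⟩
  · exact ⟨0, by rw [show (1 : ZMod 2) + 1 = 0 from rfl]; simp⟩

lemma halfRep_add_int_injective {a b : ZMod 2} {x y : ℤ}
    (h : halfRep a + x = halfRep b + y) : a = b ∧ x = y := by
  have h2 : ((a.val : ℤ) : ℝ) + 2 * x = (b.val : ℤ) + 2 * y := by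
    rw [← two_mul_halfRep, ← two_mul_halfRep]; linarith
  have h3 : (a.val : ℤ) + 2 * x = b.val + 2 * y := by exact_mod_cast h2
  have ha := a.val_lt
  have hb := b.val_lt
  have : a.val = b.val := by omega
  exact ⟨ZMod.val_injective 2 this, by omega⟩

/-! ### Isometries with diagonal linear part -/

section signedIsom

variable {m : ℕ}

/-- The isometry `x ↦ ((-1)^(aⱼ) xⱼ + tⱼ)ⱼ`. -/
noncomputable def signedIsom (a : Fin m → ZMod 2) (t : Fin m → ℝ) : EuclideanIsom m :=
  (LinearIsometryEquiv.piLpCongrRight 2 fun j =>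
      if a j = 0 then LinearIsometryEquiv.refl ℝ ℝ
      else LinearIsometryEquiv.neg ℝ).toAffineIsometryEquiv.trans
    (AffineIsometryEquiv.constVAdd ℝ _ (WithLp.toLp 2 t))

lemma signedIsom_apply (a : Fin m → ZMod 2) (t : Fin m → ℝ) (x : EuclideanSpace ℝ (Fin m))
    (j : Fin m) : signedIsom a t x j = zsign (a j) * x j + t j := by
  rcases ZMod.two_cases (a j) with h | h <;> simp [signedIsom, h, add_comm]

lemma signedIsom_linear_apply (a : Fin m → ZMod 2) (t : Fin m → ℝ)
    (x : EuclideanSpace ℝ (Fin m)) (j : Fin m) :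
    (signedIsom a t).linearIsometryEquiv x j = zsign (a j) * x j := by
  have h := (signedIsom a t).map_vadd 0 x
  have h' := congrArg (fun y : EuclideanSpace ℝ (Fin m) => y j) h
  simp only [vadd_eq_add, add_zero, PiLp.add_apply, signedIsom_apply, PiLp.zero_apply,
    mul_zero, zero_add] at h'
  linarith

lemma signedIsom_mul (a b : Fin m → ZMod 2) (t u : Fin m → ℝ) :
    signedIsom a t * signedIsom b u =
      signedIsom (a + b) (fun j => t j + zsign (a j) * u j) := by
  refine AffineIsometryEquiv.ext fun x => ?_
  ext j
  rw [AffineIsometryEquiv.coe_mul, Function.comp_apply]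
  simp only [signedIsom_apply, Pi.add_apply, zsign_add]
  push_cast
  ring

lemma signedIsom_zero_zero : signedIsom (0 : Fin m → ZMod 2) 0 = 1 := by
  refine AffineIsometryEquiv.ext fun x => ?_
  ext j
  simp [signedIsom_apply]

lemma signedIsom_injective {a b : Fin m → ZMod 2} {t u : Fin m → ℝ}
    (h : signedIsom a t = signedIsom b u) : a = b ∧ t = u := by
  have ht : t = u := by
    funext j
    have := congrArg (fun γ : EuclideanIsom m => γ 0 j) h
    simpa [signedIsom_apply] using this
  refine ⟨?_, ht⟩
  funext j
  have := congrArg (fun γ : EuclideanIsom m => γ (EuclideanSpace.single j 1) j) h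
  simp only [signedIsom_apply, ht] at this
  simp at this
  exact zsign_injective this

lemma signedIsom_inv (a : Fin m → ZMod 2) (t : Fin m → ℝ) :
    (signedIsom a t)⁻¹ = signedIsom a (fun j => - (zsign (a j) * t j)) := by
  rw [inv_eq_iff_mul_eq_one, signedIsom_mul, ← signedIsom_zero_zero]
  congr 1
  · funext j; exact CharTwo.add_self_eq_zero _
  · funext j
    have : ((zsign (a j) : ℝ)) * zsign (a j) = 1 := by exact_mod_cast zsign_mul_self (a j)
    simp only [Pi.zero_apply]
    linear_combination (-t j) * this

lemma constVAdd_eq_signedIsom (v : EuclideanSpace ℝ (Fin m)) :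
    AffineIsometryEquiv.constVAdd ℝ (EuclideanSpace ℝ (Fin m)) v = signedIsom 0 v := by
  refine AffineIsometryEquiv.ext fun x => ?_
  ext j
  simp [signedIsom_apply, add_comm]

lemma signedIsom_pow_apply (a : Fin m → ZMod 2) (t : Fin m → ℝ) {j : Fin m} (h : a j = 0)
    (N : ℕ) : ((signedIsom a t) ^ N) 0 j = N * t j := by
  induction N with
  | zero => simp
  | succ N ih =>
    rw [pow_succ', AffineIsometryEquiv.coe_mul, Function.comp_apply, signedIsom_apply, ih, h]
    push_cast
    simp only [zsign_zero]
    push_cast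
    ring

lemma eq_zero_of_isOfFinOrder_signedIsom {a : Fin m → ZMod 2} {t : Fin m → ℝ}
    (hf : IsOfFinOrder (signedIsom a t)) {j : Fin m} (h : a j = 0) : t j = 0 := by
  obtain ⟨N, hN, hN1⟩ := isOfFinOrder_iff_pow_eq_one.1 hf
  have h1 := signedIsom_pow_apply a t h N
  rw [hN1] at h1
  simp at h1
  rcases h1 with h1 | h1
  · omega
  · exact h1

end signedIsom

/-! ### The group attached to characters and half-translations -/

section diagonalGroup

variable {k m : ℕ}

/-- Every nonzero vector `v` has an index `i` with `χᵢ(v) = 0` and `sᵢ(v) = 1`. -/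
def Covers {ι : Type*} (χ s : ι → Fin k → ZMod 2) : Prop :=
  ∀ v, v ≠ 0 → ∃ i, χ i ⬝ᵥ v = 0 ∧ s i ⬝ᵥ v = 1

/-- The characters `χᵢ` have no common nonzero zero. -/
def Separates {ι : Type*} (χ : ι → Fin k → ZMod 2) : Prop :=
  ∀ v, (∀ i, χ i ⬝ᵥ v = 0) → v = 0

/-- The group of isometries `x ↦ ((-1)^(χⱼ(g)) xⱼ + sⱼ(g)/2 + zⱼ)ⱼ` for `g : C₂ᵏ`, `z : ℤᵐ`. -/
noncomputable def diagonalGroup (χ s : Fin m → Fin k → ZMod 2) : Subgroup (EuclideanIsom m) where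
  carrier := {γ | ∃ (g : Fin k → ZMod 2) (z : Fin m → ℤ),
    γ = signedIsom (fun j => χ j ⬝ᵥ g) (fun j => halfRep (s j ⬝ᵥ g) + z j)}
  one_mem' := ⟨0, 0, by
    rw [← signedIsom_zero_zero]
    congr 1 <;> funext j <;> simp⟩
  mul_mem' := by
    rintro _ _ ⟨g, z, rfl⟩ ⟨h, w, rfl⟩
    choose c hc using fun j => exists_halfRep_add (s j ⬝ᵥ g) (s j ⬝ᵥ h) (χ j ⬝ᵥ g)
    refine ⟨g + h, fun j => z j + zsign (χ j ⬝ᵥ g) * w j + c j, ?_⟩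
    rw [signedIsom_mul]
    congr 1
    · funext j; simp [dotProduct_add]
    · funext j
      rw [dotProduct_add]
      push_cast
      linear_combination hc j
  inv_mem' := by
    rintro _ ⟨g, z, rfl⟩
    choose c hc using fun j => exists_halfRep_add (s j ⬝ᵥ g) (s j ⬝ᵥ g) (χ j ⬝ᵥ g)
    refine ⟨g, fun j => -(zsign (χ j ⬝ᵥ g) * z j) - c j, ?_⟩
    rw [signedIsom_inv]
    congr 1
    funext j
    have := hc j
    rw [CharTwo.add_self_eq_zero, halfRep_zero] at this
    push_cast
    linear_combination -this

lemma mem_diagonalGroup {χ s : Fin m → Fin k → ZMod 2} {γ : EuclideanIsom m} :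
    γ ∈ diagonalGroup χ s ↔ ∃ (g : Fin k → ZMod 2) (z : Fin m → ℤ),
      γ = signedIsom (fun j => χ j ⬝ᵥ g) (fun j => halfRep (s j ⬝ᵥ g) + z j) := Iff.rfl

lemma abs_int_half_lt {x y : ℤ} {a b : ZMod 2}
    (h : |(halfRep a + x) - (halfRep b + y)| < 1 / 2) : halfRep a + x = halfRep b + y := by
  have h1 := two_mul_halfRep a
  have h2 := two_mul_halfRep b
  have h3 : |(((a.val : ℤ) + 2 * x - (b.val + 2 * y) : ℤ) : ℝ)| < 1 := by
    have : (((a.val : ℤ) + 2 * x - (b.val + 2 * y) : ℤ) : ℝ)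
        = 2 * ((halfRep a + x) - (halfRep b + y)) := by
      push_cast at h1 h2 ⊢; linarith
    rw [this, abs_mul, abs_two]; linarith
  have h4 : |(a.val : ℤ) + 2 * x - (b.val + 2 * y)| < 1 := by exact_mod_cast h3
  rw [Int.abs_lt_one_iff] at h4
  have h5 : (((a.val : ℤ) + 2 * x - (b.val + 2 * y) : ℤ) : ℝ) = 0 := by exact_mod_cast h4
  push_cast at h1 h2 h5
  linarith

lemma abs_zsign_sub_lt {a b : ZMod 2} (h : |(zsign a : ℝ) - zsign b| < 1 / 2) : a = b := by
  rcases ZMod.two_cases a with rfl | rfl <;> rcases ZMod.two_cases b with rfl | rfl <;>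
    first | rfl | (exfalso; revert h; norm_num [abs_lt])

lemma discreteTopology_diagonalGroup (χ s : Fin m → Fin k → ZMod 2) :
    DiscreteTopology (diagonalGroup χ s) := by
  rw [discreteTopology_iff_isOpen_singleton]
  rintro ⟨γ, hγ⟩
  -- The radius `1/2` isolates an element: distinct signs differ by `2`, and distinct elements of
  -- `½ℤ` by at least `1/2`.
  refine isOpen_induced_iff.2 ⟨EuclideanIsom.toPair ⁻¹' (Metric.ball γ.toPair (1 / 2)),
    isOpen_induced_iff.2 ⟨_, Metric.isOpen_ball, rfl⟩, ?_⟩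
  ext ⟨δ, hδ⟩
  simp only [Set.mem_preimage, Set.mem_singleton_iff, Subtype.mk.injEq]
  refine ⟨fun h => ?_, fun h => by subst h; simp⟩
  rw [Metric.mem_ball, Prod.dist_eq, max_lt_iff, dist_eq_norm, dist_eq_norm] at h
  obtain ⟨hl, ht⟩ := h
  obtain ⟨g, z, rfl⟩ := hγ
  obtain ⟨g', z', rfl⟩ := hδ
  congr 1
  · funext j
    apply abs_zsign_sub_lt
    have h1 := ContinuousLinearMap.le_opNorm
      ((EuclideanIsom.toPair (signedIsom (fun j => χ j ⬝ᵥ g')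
          fun j => halfRep (s j ⬝ᵥ g') + z' j)).1 -
        (EuclideanIsom.toPair (signedIsom (fun j => χ j ⬝ᵥ g)
          fun j => halfRep (s j ⬝ᵥ g) + z j)).1) (EuclideanSpace.single j (1 : ℝ))
    rw [PiLp.norm_single, norm_one, mul_one] at h1
    refine lt_of_le_of_lt (le_trans ?_ h1) hl
    refine le_trans (le_of_eq ?_) (PiLp.norm_apply_le _ j)
    rw [Real.norm_eq_abs]
    congr 1
    simp [EuclideanIsom.toPair, signedIsom_linear_apply]
  · funext j
    apply abs_int_half_lt
    refine lt_of_le_of_lt (le_trans (le_of_eq ?_) (PiLp.norm_apply_le _ j)) ht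
    rw [Real.norm_eq_abs]
    congr 1
    simp [EuclideanIsom.toPair, signedIsom_apply]

lemma cocompact_diagonalGroup (χ s : Fin m → Fin k → ZMod 2) :
    ∃ K : Set (EuclideanSpace ℝ (Fin m)), IsCompact K ∧
      ∀ x : EuclideanSpace ℝ (Fin m), ∃ γ ∈ diagonalGroup χ s, γ x ∈ K := by
  refine ⟨(EuclideanSpace.equiv (Fin m) ℝ).toHomeomorph ⁻¹' Set.Icc 0 1,
    ((EuclideanSpace.equiv (Fin m) ℝ).toHomeomorph.isCompact_preimage).2 isCompact_Icc,
    fun x => ⟨_, ⟨0, fun j => -⌊x j⌋, rfl⟩, ?_⟩⟩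
  rw [Set.mem_preimage, Set.mem_Icc]
  constructor
  · intro j
    change (0 : ℝ) ≤ signedIsom _ _ x j
    simp only [signedIsom_apply, dotProduct_zero, zsign_zero, halfRep_zero]
    push_cast
    linarith [Int.floor_le (x j)]
  · intro j
    change signedIsom _ _ x j ≤ (1 : ℝ)
    simp only [signedIsom_apply, dotProduct_zero, zsign_zero, halfRep_zero]
    push_cast
    linarith [Int.lt_floor_add_one (x j)]

/-- In a coordinate fixed by the linear part, powers multiply the translation part, so finite order
forces it to vanish. At a covering index this part lies in `1/2 + ℤ`, which is impossible. -/
lemma isBieberbachGroup_diagonalGroup {χ s : Fin m → Fin k → ZMod 2} (hc : Covers χ s) :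
    IsBieberbachGroup (diagonalGroup χ s) := by
  refine ⟨⟨discreteTopology_diagonalGroup χ s, cocompact_diagonalGroup χ s⟩, ?_⟩
  rintro _ ⟨g, z, rfl⟩ hf
  by_cases hg : g = 0
  · subst hg
    rw [← signedIsom_zero_zero]
    congr 1
    · funext j; simp
    · funext j
      exact eq_zero_of_isOfFinOrder_signedIsom hf (by simp)
  · obtain ⟨j, hj, hs⟩ := hc g hg
    have := eq_zero_of_isOfFinOrder_signedIsom hf (j := j) hj
    have h0 : halfRep (s j ⬝ᵥ g) + z j = halfRep 0 + (0 : ℤ) := by simpa using this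
    have := (halfRep_add_int_injective h0).1
    rw [hs] at this
    exact absurd this one_ne_zero

lemma mem_holonomyGroup_diagonalGroup {χ s : Fin m → Fin k → ZMod 2}
    {A : EuclideanSpace ℝ (Fin m) ≃ₗᵢ[ℝ] EuclideanSpace ℝ (Fin m)}
    (hA : A ∈ holonomyGroup (diagonalGroup χ s)) :
    ∃ g : Fin k → ZMod 2, ∀ x j, A x j = zsign (χ j ⬝ᵥ g) * x j := by
  obtain ⟨⟨_, g, z, rfl⟩, rfl⟩ := hA
  exact ⟨g, fun x j => signedIsom_linear_apply _ _ x j⟩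

/-- Separation forces every translation to lie over `g = 0`, so the lattice is exactly `ℤᵐ` with its
standard basis. -/
lemma hasDiagonalHolonomy_diagonalGroup {χ s : Fin m → Fin k → ZMod 2} (hs : Separates χ) :
    HasDiagonalHolonomy (diagonalGroup χ s) := by
  refine ⟨(EuclideanSpace.basisFun (Fin m) ℝ).toBasis, fun v => ?_, fun A hA i => ?_⟩
  · rw [Module.Basis.mem_span_iff_repr_mem, constVAdd_eq_signedIsom, mem_diagonalGroup]
    constructor
    · rintro ⟨g, z, h⟩ i
      obtain ⟨h1, h2⟩ := signedIsom_injective h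
      have hg : g = 0 := hs g fun i => (congrFun h1 i).symm
      refine ⟨z i, ?_⟩
      have := congrFun h2 i
      simp [hg] at this
      simp [this]
    · intro h
      choose z hz using h
      refine ⟨0, z, ?_⟩
      congr 1
      · funext j; simp
      · funext j
        have := hz j
        simp at this
        simp [this]
  · obtain ⟨g, hg⟩ := mem_holonomyGroup_diagonalGroup hA
    rcases ZMod.two_cases (χ i ⬝ᵥ g) with h | h
    · left
      ext j
      rw [hg]
      by_cases hij : j = i
      · subst hij; simp [h]
      · simp [hij]
    · right
      ext j
      rw [hg]
      by_cases hij : j = i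
      · subst hij; simp [h]
      · simp [hij]

/-- If all characters vanish and the half-translations exhaust `{0, 1/2}ᵐ`, then the group is the
lattice `½ℤᵐ`. -/
lemma hasDiagonalHolonomy_diagonalGroup_of_trivial {χ s : Fin m → Fin k → ZMod 2}
    (hχ : ∀ j, χ j = 0) (hs : ∀ w : Fin m → ZMod 2, ∃ g, ∀ j, s j ⬝ᵥ g = w j) :
    HasDiagonalHolonomy (diagonalGroup χ s) := by
  refine ⟨(EuclideanSpace.basisFun (Fin m) ℝ).toBasis.unitsSMul
    fun _ => (Units.mk0 (1 / 2 : ℝ) (by norm_num)), fun v => ?_, fun A hA i => ?_⟩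
  · rw [Module.Basis.mem_span_iff_repr_mem, constVAdd_eq_signedIsom, mem_diagonalGroup]
    constructor
    · rintro ⟨g, z, h⟩ i
      obtain ⟨h1, h2⟩ := signedIsom_injective h
      refine ⟨(s i ⬝ᵥ g).val + 2 * z i, ?_⟩
      have h3 := congrFun h2 i
      have h4 := two_mul_halfRep (s i ⬝ᵥ g)
      simp [Module.Basis.repr_unitsSMul, Units.smul_def] at h4 ⊢
      rw [h3, ← h4]
      ring
    · intro h
      choose z hz using h
      -- The parities of the coordinates of a point of `½ℤᵐ` select `g`; the integral quotients by
      -- `2` supply the rest.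
      obtain ⟨g, hg⟩ := hs fun j => (z j : ZMod 2)
      refine ⟨g, fun j => z j / 2, ?_⟩
      congr 1
      · funext j; simp [hχ]
      · funext j
        have h1 := hz j
        simp [Module.Basis.repr_unitsSMul, Units.smul_def] at h1
        have h2 := two_mul_halfRep (z j : ZMod 2)
        have h3 : (((z j : ZMod 2).val : ℕ) : ℤ) = z j % 2 := by
          rw [ZMod.val_intCast]; rfl
        rw [hg]
        rw [h3] at h2
        have h4 : (((z j % 2 + 2 * (z j / 2) : ℤ)) : ℝ) = z j := by rw [Int.emod_add_mul_ediv]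
        push_cast at h4
        linarith
  · obtain ⟨g, hg⟩ := mem_holonomyGroup_diagonalGroup hA
    left
    ext j
    rw [hg]
    simp [hχ]

lemma holonomyGroup_diagonalGroup_equiv {χ s : Fin m → Fin k → ZMod 2} (hs : Separates χ) :
    Nonempty (holonomyGroup (diagonalGroup χ s) ≃* ElementaryTwoGroup k) := by
  let f : ElementaryTwoGroup k →*
      (EuclideanSpace ℝ (Fin m) ≃ₗᵢ[ℝ] EuclideanSpace ℝ (Fin m)) :=
    MonoidHom.mk' (fun g => (signedIsom (fun j => χ j ⬝ᵥ g.toAdd) 0).linearIsometryEquiv) (by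
      intro a b
      ext x j
      rw [LinearIsometryEquiv.coe_mul, Function.comp_apply]
      simp only [signedIsom_linear_apply, toAdd_mul, dotProduct_add, zsign_add]
      push_cast
      ring)
  have hfa (g : ElementaryTwoGroup k) (x : EuclideanSpace ℝ (Fin m)) (j : Fin m) :
      f g x j = zsign (χ j ⬝ᵥ g.toAdd) * x j := signedIsom_linear_apply _ _ x j
  have hf : Function.Injective f := by
    rw [injective_iff_map_eq_one]
    intro a ha
    have : a.toAdd = 0 := by
      refine hs _ fun j => zsign_injective ?_
      have h := congrArg (fun A : EuclideanSpace ℝ (Fin m) ≃ₗᵢ[ℝ] EuclideanSpace ℝ (Fin m) =>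
        A (EuclideanSpace.single j 1) j) ha
      simp only [hfa] at h
      simp at h
      exact_mod_cast h
    exact toAdd_eq_zero.1 this
  have hr : f.range = holonomyGroup (diagonalGroup χ s) := by
    ext A
    constructor
    · rintro ⟨g, rfl⟩
      refine ⟨⟨_, g.toAdd, 0, rfl⟩, ?_⟩
      ext x j
      exact (signedIsom_linear_apply _ _ x j).trans (hfa _ x j).symm
    · intro hA
      obtain ⟨g, hg⟩ := mem_holonomyGroup_diagonalGroup hA
      refine ⟨Multiplicative.ofAdd g, ?_⟩
      ext x j
      exact (hfa _ x j).trans (hg x j).symm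
  exact ⟨(MulEquiv.subgroupCongr hr).symm.trans (MonoidHom.ofInjective hf).symm⟩

end diagonalGroup

/-! ### Squares and abelian subgroups in groups of diagonal type -/

lemma EuclideanIsom.apply_eq {n : ℕ} (γ : EuclideanIsom n) (x : EuclideanSpace ℝ (Fin n)) :
    γ x = γ.linearIsometryEquiv x + γ 0 := by
  have := γ.map_vadd 0 x
  simpa using this

lemma EuclideanIsom.eq_constVAdd {n : ℕ} {γ : EuclideanIsom n}
    (h : γ.linearIsometryEquiv = 1) :
    γ = AffineIsometryEquiv.constVAdd ℝ (EuclideanSpace ℝ (Fin n)) (γ 0) := by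
  refine AffineIsometryEquiv.ext fun x => ?_
  rw [EuclideanIsom.apply_eq, h]
  simp [add_comm]

lemma EuclideanIsom.coe_eq_constVAdd {n : ℕ} {Γ : Subgroup (EuclideanIsom n)} {γ : Γ}
    (h : holonomyHom Γ γ = 1) :
    (γ : EuclideanIsom n) =
      AffineIsometryEquiv.constVAdd ℝ (EuclideanSpace ℝ (Fin n)) ((γ : EuclideanIsom n) 0) :=
  EuclideanIsom.eq_constVAdd h

lemma EuclideanIsom.sq_linear_eq_one {n : ℕ} {Γ : Subgroup (EuclideanIsom n)}
    {b : Module.Basis (Fin n) ℝ (EuclideanSpace ℝ (Fin n))}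
    (hh : ∀ g ∈ holonomyGroup Γ, ∀ i, g (b i) = b i ∨ g (b i) = -b i) (γ : Γ) :
    holonomyHom Γ (γ ^ 2) = 1 := by
  have hg := hh _ (⟨γ, rfl⟩ : holonomyHom Γ γ ∈ holonomyGroup Γ)
  rw [map_pow, pow_two]
  refine LinearIsometryEquiv.toLinearEquiv_injective (LinearEquiv.toLinearMap_injective
    (b.ext fun i => ?_))
  change (holonomyHom Γ γ) ((holonomyHom Γ γ) (b i)) = b i
  rcases hg i with h | h <;> rw [h]
  · exact h
  · rw [map_neg, h, neg_neg]

/-- A group of diagonal type in dimension `m` contains no free abelian group of rank above `m`: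
squares of its elements are translations. -/
lemma card_le_of_injective_of_hasDiagonalHolonomy {ι : Type*} [Fintype ι] {m : ℕ}
    {Γ : Subgroup (EuclideanIsom m)} (hD : HasDiagonalHolonomy Γ)
    (ψ : Multiplicative (ι → ℤ) →* Γ) (hψ : Function.Injective ψ) : Fintype.card ι ≤ m := by
  obtain ⟨b, hb, hh⟩ := hD
  have hsq (γ : Γ) : ((γ ^ 2 : Γ) : EuclideanIsom m).linearIsometryEquiv = 1 :=
    EuclideanIsom.sq_linear_eq_one hh γ
  let T (z : ι → ℤ) : EuclideanIsom m := ((ψ (Multiplicative.ofAdd z) ^ 2 : Γ) : EuclideanIsom m)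
  have hT (z : ι → ℤ) : T z = AffineIsometryEquiv.constVAdd ℝ _ (T z 0) :=
    EuclideanIsom.eq_constVAdd (hsq _)
  have hTm (z w : ι → ℤ) : T (z + w) = T z * T w := by
    simp only [T]
    rw [← Subgroup.coe_mul, ofAdd_add, map_mul,
      ((Commute.all (Multiplicative.ofAdd z) (Multiplicative.ofAdd w)).map ψ).mul_pow]
  have hT0 (z w : ι → ℤ) : T (z + w) 0 = T z 0 + T w 0 := by
    rw [hTm, AffineIsometryEquiv.coe_mul, Function.comp_apply, EuclideanIsom.apply_eq]
    rw [show (T z).linearIsometryEquiv = 1 from hsq _, add_comm]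
    rfl
  have hmem (z : ι → ℤ) : T z 0 ∈ Submodule.span ℤ (Set.range b) :=
    (hb _).1 (by rw [← hT]; exact SetLike.coe_mem _)
  let f : (ι → ℤ) →+ Submodule.span ℤ (Set.range b) :=
    AddMonoidHom.mk' (fun z => ⟨T z 0, hmem z⟩) fun z w => Subtype.ext (hT0 z w)
  have hf : Function.Injective f := by
    rw [injective_iff_map_eq_zero]
    intro z hz
    have h0 : T z 0 = 0 := congrArg Subtype.val hz
    have h1 : T z = 1 := by
      rw [hT, h0]
      exact AffineIsometryEquiv.ext fun x => by simp
    have h2 : ψ (Multiplicative.ofAdd z) ^ 2 = 1 := Subtype.ext h1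
    rw [← map_pow, ← map_one ψ] at h2
    have h3 := congrArg Multiplicative.toAdd (hψ h2)
    rw [toAdd_pow, toAdd_ofAdd, toAdd_one] at h3
    funext i
    have := congrFun h3 i
    simpa using this
  have hfin := Module.Finite.span_of_finite ℤ (Set.finite_range b)
  have h := LinearMap.finrank_le_finrank_of_injective (f := f.toIntLinearMap) hf
  rwa [finrank_span_eq_card (b.linearIndependent.restrict_scalars' ℤ), Module.finrank_fintype_fun_eq_card,
    Fintype.card_fin] at h

/-! ### Lower bound from private vectors -/

section lower

variable {k n : ℕ} (χ s : Fin n → Fin k → ZMod 2)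

/-- The element of `diagonalGroup χ s` over `g : C₂ᵏ` with integral translation part `z`. -/
noncomputable def diagonalGroup.lift (g : Fin k → ZMod 2) (z : Fin n → ℤ) : diagonalGroup χ s :=
  ⟨signedIsom (fun j => χ j ⬝ᵥ g) (fun j => halfRep (s j ⬝ᵥ g) + z j), g, z, rfl⟩

/-- The lattice translations of `diagonalGroup χ s`. -/
noncomputable def diagonalGroup.translation :
    Multiplicative (Fin n → ℤ) →* diagonalGroup χ s :=
  MonoidHom.mk' (fun z => diagonalGroup.lift χ s 0 z.toAdd) fun z w => Subtype.ext <| by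
    change signedIsom _ _ = signedIsom _ _ * signedIsom _ _
    rw [signedIsom_mul]
    congr 1 <;> funext j <;> simp

variable {χ s}

lemma diagonalGroup.coe_translation (z : Multiplicative (Fin n → ℤ)) :
    (diagonalGroup.translation χ s z : EuclideanIsom n) =
      signedIsom 0 fun j => (z.toAdd j : ℝ) := by
  change signedIsom _ _ = _
  congr 1 <;> funext j <;> simp

lemma diagonalGroup.conj_translation (g : Fin k → ZMod 2) (z : Fin n → ℤ) :
    diagonalGroup.lift χ s g 0 * diagonalGroup.translation χ s (Multiplicative.ofAdd z) *
        (diagonalGroup.lift χ s g 0)⁻¹ =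
      diagonalGroup.translation χ s (Multiplicative.ofAdd fun j => zsign (χ j ⬝ᵥ g) * z j) := by
  rw [mul_inv_eq_iff_eq_mul]
  apply Subtype.ext
  rw [Subgroup.coe_mul, Subgroup.coe_mul, coe_translation, coe_translation]
  change signedIsom _ _ * _ = _ * signedIsom _ _
  rw [signedIsom_mul, signedIsom_mul]
  congr 1
  · rw [add_comm]
  · funext j
    simp
    ring

lemma diagonalGroup.eq_zero_of_lift_mem (hs : Separates χ) {g : Fin k → ZMod 2} {z : Fin n → ℤ}
    (h : diagonalGroup.lift χ s g z ∈ latticeSubgroup (diagonalGroup χ s)) : g = 0 := by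
  refine hs g fun j => zsign_injective ?_
  have h1 : (signedIsom (fun j => χ j ⬝ᵥ g)
    (fun j => halfRep (s j ⬝ᵥ g) + (z j : ℝ))).linearIsometryEquiv = 1 := h
  have h2 := signedIsom_linear_apply (fun j => χ j ⬝ᵥ g)
    (fun j => halfRep (s j ⬝ᵥ g) + (z j : ℝ)) (EuclideanSpace.single j 1) j
  rw [h1] at h2
  simp at h2
  exact_mod_cast h2.symm

/-- A vector at which the index `i` is the only one witnessing `Covers`. -/
def IsPrivateVector {ι : Type*} (χ s : ι → Fin k → ZMod 2) (i : ι) (v : Fin k → ZMod 2) : Prop :=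
  χ i ⬝ᵥ v = 0 ∧ s i ⬝ᵥ v = 1 ∧ ∀ j, j ≠ i → χ j ⬝ᵥ v = 0 → s j ⬝ᵥ v = 0

/-- On squaring, a reflected coordinate cancels its own translation part, and an unreflected `j ≠ i`
has none because `v` is private to `i`. Only `1/2 + 1/2` in coordinate `i` remains. -/
lemma diagonalGroup.lift_sq {i : Fin n} {v : Fin k → ZMod 2} (h : IsPrivateVector χ s i v) :
    diagonalGroup.lift χ s v 0 ^ 2 =
      diagonalGroup.translation χ s (Multiplicative.ofAdd (Pi.single i 1)) := by
  obtain ⟨h0, h1, h2⟩ := h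
  apply Subtype.ext
  rw [pow_two, Subgroup.coe_mul, coe_translation]
  change signedIsom _ _ * signedIsom _ _ = _
  rw [signedIsom_mul]
  congr 1
  · funext j; exact CharTwo.add_self_eq_zero _
  · funext j
    by_cases hj : j = i
    · subst hj
      simp [h0, h1]
      norm_num
    · rcases ZMod.two_cases (χ j ⬝ᵥ v) with hc | hc
      · simp [h2 j hj hc, hj]
      · simp [hc, hj]

/-- If the characters are distinct, the coordinates with a private vector vanish on every normal
subgroup of translations with torsion-free quotient. -/
lemma diagonalGroup.coord_eq_zero (hχ : Function.Injective χ) (hs : Separates χ)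
    {M : Subgroup (diagonalGroup χ s)} [hn : M.Normal]
    (hM : M ≤ latticeSubgroup (diagonalGroup χ s))
    (ht : ∀ (γ : diagonalGroup χ s) (N : ℕ), 0 < N → γ ^ N ∈ M → γ ∈ M)
    {i : Fin n} {p : Fin k → ZMod 2} (hp : IsPrivateVector χ s i p) {z : Fin n → ℤ}
    (hz : diagonalGroup.translation χ s (Multiplicative.ofAdd z) ∈ M) : z i = 0 := by
  by_contra hzi
  -- The coordinates in `A` are killed one at a time while coordinate `i` stays nonzero.
  have key : ∀ A : Finset (Fin n), i ∉ A → ∃ v : Fin n → ℤ,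
      diagonalGroup.translation χ s (Multiplicative.ofAdd v) ∈ M ∧ v i ≠ 0 ∧ ∀ j ∈ A, v j = 0 := by
    intro A
    induction A using Finset.induction_on with
    | empty => exact fun _ => ⟨z, hz, hzi, by simp⟩
    | insert j A hj ih =>
      intro hi
      rw [Finset.mem_insert, not_or] at hi
      obtain ⟨v, hv, hvi, hvA⟩ := ih hi.2
      obtain ⟨g, hg⟩ : ∃ g, χ j ⬝ᵥ g ≠ χ i ⬝ᵥ g := by
        by_contra! h
        exact hi.1 (hχ (dotProduct_eq _ _ h)).symm
      -- Coordinate `l` is multiplied by `1 + (-1)^(χᵢ(g) + χₗ(g))`: it doubles at `i`, cancels at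
      -- `j`, and stays zero wherever it was zero.
      refine ⟨v + zsign (χ i ⬝ᵥ g) • fun l => zsign (χ l ⬝ᵥ g) * v l, ?_, ?_, ?_⟩
      · rw [ofAdd_add, map_mul, ofAdd_zsmul, map_zpow, ← conj_translation]
        exact M.mul_mem hv (M.zpow_mem (hn.conj_mem _ hv _) _)
      · simp only [Pi.add_apply, Pi.smul_apply, smul_eq_mul, ← mul_assoc, zsign_mul_self]
        omega
      · intro l hl
        simp only [Pi.add_apply, Pi.smul_apply, smul_eq_mul]
        rcases Finset.mem_insert.1 hl with rfl | hl
        · have : zsign (χ i ⬝ᵥ g) * zsign (χ l ⬝ᵥ g) = -1 := by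
            rw [← zsign_add]
            have : χ i ⬝ᵥ g + χ l ⬝ᵥ g = 1 := by
              revert hg
              generalize χ i ⬝ᵥ g = a
              generalize χ l ⬝ᵥ g = b
              revert a b; decide
            rw [this, zsign_one]
          rw [← mul_assoc, this]; ring
        · rw [hvA l hl]; simp
  obtain ⟨v, hv, hvi, hvA⟩ := key (Finset.univ.erase i) (by simp)
  have hve : v = v i • Pi.single i 1 := by
    funext j
    by_cases hj : j = i
    · subst hj; simp
    · simp [hj, hvA j (by simp [hj])]
  rw [hve, ofAdd_zsmul, map_zpow] at hv
  have he : diagonalGroup.translation χ s (Multiplicative.ofAdd (Pi.single i 1)) ∈ M := by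
    refine ht _ (v i).natAbs (Int.natAbs_pos.2 hvi) ?_
    rcases Int.natAbs_eq (v i) with h | h
    · rw [h, zpow_natCast] at hv; exact hv
    · rw [h, zpow_neg, zpow_natCast] at hv; exact M.inv_mem_iff.1 hv
  rw [← lift_sq hp] at he
  have h0 := eq_zero_of_lift_mem hs (hM (ht _ 2 two_pos he))
  have := hp.2.1
  rw [h0, dotProduct_zero] at this
  exact zero_ne_one this

/-- Torsion-freeness of the quotient makes `M` closed under roots, so `diagonalGroup.coord_eq_zero`
embeds `ℤᴾ` into the quotient, whose dimension bounds the rank of such a subgroup. -/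
theorem card_le_of_diagonalVasquezProperty (hχ : Function.Injective χ) (hs : Separates χ)
    (hc : Covers χ s) {P : Finset (Fin n)} (hP : ∀ i ∈ P, ∃ v, IsPrivateVector χ s i v) {N : ℕ}
    (hN : DiagonalVasquezProperty (ElementaryTwoGroup k) N) : P.card ≤ N := by
  obtain ⟨M, hn, hM, m, hm, Γ, hB, hD, ⟨φ⟩⟩ := hN n (diagonalGroup χ s)
    (isBieberbachGroup_diagonalGroup hc) (hasDiagonalHolonomy_diagonalGroup hs)
    (holonomyGroup_diagonalGroup_equiv hs)
  refine le_trans ?_ hm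
  have ht : ∀ (γ : diagonalGroup χ s) (N : ℕ), 0 < N → γ ^ N ∈ M → γ ∈ M := by
    intro γ N hN h
    have h1 : (QuotientGroup.mk γ : diagonalGroup χ s ⧸ M) ^ N = 1 := by
      rw [← QuotientGroup.mk_pow]; exact (QuotientGroup.eq_one_iff _).2 h
    have h2 := hB.torsion_free (φ (QuotientGroup.mk γ)) (SetLike.coe_mem _)
      (isOfFinOrder_iff_pow_eq_one.2 ⟨N, hN, by
        rw [← Subgroup.coe_pow, ← map_pow, h1, map_one, Subgroup.coe_one]⟩)
    have h3 : φ (QuotientGroup.mk γ) = 1 := Subtype.ext h2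
    rw [MulEquiv.map_eq_one_iff] at h3
    exact (QuotientGroup.eq_one_iff _).1 h3
  let ext : (P → ℤ) →+ (Fin n → ℤ) := AddMonoidHom.mk'
    (fun z j => if h : j ∈ P then z ⟨j, h⟩ else 0) (by
      intro z w; funext j; by_cases h : j ∈ P <;> simp [h])
  let ψ : Multiplicative (P → ℤ) →* Γ := φ.toMonoidHom.comp ((QuotientGroup.mk' M).comp
    ((diagonalGroup.translation χ s).comp (AddMonoidHom.toMultiplicative ext)))
  have hψ : Function.Injective ψ := by
    rw [injective_iff_map_eq_one]
    intro z hz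
    have h1 : (QuotientGroup.mk (diagonalGroup.translation χ s
        (Multiplicative.ofAdd (ext z.toAdd))) : diagonalGroup χ s ⧸ M) = 1 :=
      (MulEquiv.map_eq_one_iff φ).1 hz
    rw [QuotientGroup.eq_one_iff] at h1
    apply toAdd_eq_zero.1
    funext ⟨i, hi⟩
    obtain ⟨v, hv⟩ := hP i hi
    have := diagonalGroup.coord_eq_zero hχ hs hM ht hv h1
    simpa [ext, hi] using this
  have := card_le_of_injective_of_hasDiagonalHolonomy hD ψ hψ
  rwa [Fintype.card_coe] at this

/-- The lower bound for families indexed by an arbitrary finite type. -/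
theorem card_le_of_diagonalVasquezProperty' {ι : Type*} [Fintype ι] {χ s : ι → Fin k → ZMod 2}
    (hχ : Function.Injective χ) (hs : Separates χ) (hc : Covers χ s) {P : Finset ι}
    (hP : ∀ i ∈ P, ∃ v, IsPrivateVector χ s i v) {N : ℕ}
    (hN : DiagonalVasquezProperty (ElementaryTwoGroup k) N) : P.card ≤ N := by
  let e := Fintype.equivFin ι
  have := card_le_of_diagonalVasquezProperty (χ := χ ∘ e.symm) (s := s ∘ e.symm)
    (P := P.map e.toEmbedding) (hχ.comp e.symm.injective)
    (fun v hv => hs v fun i => by simpa using hv (e i))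
    (fun v hv => by
      obtain ⟨i, hi⟩ := hc v hv
      exact ⟨e i, by simpa using hi⟩)
    (fun i hi => by
      obtain ⟨j, hj, rfl⟩ := Finset.mem_map.1 hi
      obtain ⟨v, h1, h2, h3⟩ := hP j hj
      refine ⟨v, by simpa using h1, by simpa using h2, fun l hl => h3 _ fun h => hl ?_⟩
      rw [← h]; simp) hN
  rwa [Finset.card_map] at this

end lower

/-- The characters are the three nonzero ones; the kernel of each contains one nonzero vector, which
is private to it. -/
lemma three_le_of_diagonalVasquezProperty {N : ℕ}
    (hN : DiagonalVasquezProperty (ElementaryTwoGroup 2) N) : 3 ≤ N := by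
  have := card_le_of_diagonalVasquezProperty (k := 2) (n := 3)
    (χ := ![![1, 1], ![0, 1], ![1, 0]]) (s := ![![1, 0], ![1, 0], ![0, 1]])
    (by decide) (by unfold Separates; decide) (by unfold Covers; decide) (P := Finset.univ)
    (by unfold IsPrivateVector; decide) hN
  simpa using this

/-- The general family fails in rank three, where `∑_{l ≠ i} x_l` is itself a sum of two coordinates
and the characters are no longer distinct. Five explicit coordinates replace it. -/
lemma five_le_of_diagonalVasquezProperty {N : ℕ}
    (hN : DiagonalVasquezProperty (ElementaryTwoGroup 3) N) : 5 ≤ N := by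
  have := card_le_of_diagonalVasquezProperty (k := 3) (n := 5)
    (χ := ![![1, 0, 0], ![0, 1, 0], ![1, 1, 0], ![1, 1, 1], ![0, 1, 1]])
    (s := ![![0, 1, 1], ![1, 0, 1], ![1, 0, 1], ![0, 0, 1], ![0, 0, 1]])
    (by decide) (by unfold Separates; decide) (by unfold Covers; decide) (P := Finset.univ)
    (by unfold IsPrivateVector; decide) hN
  simpa using this

/-! ### The family indexed by pairs, for `k ≥ 4` -/

section pairFamily

variable {k : ℕ}

/-- The characters `xᵢ + xⱼ` for `i < j` and `∑_{l ≠ i} x_l`, and the extra character `x_o`. -/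
def pairChar (o : Fin k) : Option {p : Fin k × Fin k // p.1 ≤ p.2} → Fin k → ZMod 2
  | none => fun a => if a = o then 1 else 0
  | some p => fun a => if p.1.1 = p.1.2 then (if a = p.1.1 then 0 else 1)
      else (if a = p.1.1 ∨ a = p.1.2 then 1 else 0)

/-- The half-translations `xᵢ` of the index `(i, j)`; the extra index has none. -/
def pairShift : Option {p : Fin k × Fin k // p.1 ≤ p.2} → Fin k → ZMod 2
  | none => 0
  | some p => Pi.single p.1.1 1

lemma pairChar_none_dotProduct (o : Fin k) (v : Fin k → ZMod 2) :
    pairChar o none ⬝ᵥ v = v o := by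
  simp [pairChar, dotProduct]

lemma pairChar_some_dotProduct (o : Fin k) {p : {p : Fin k × Fin k // p.1 ≤ p.2}}
    (hp : p.1.1 ≠ p.1.2) (v : Fin k → ZMod 2) :
    pairChar o (some p) ⬝ᵥ v = v p.1.1 + v p.1.2 := by
  have : pairChar o (some p) = Pi.single p.1.1 1 + Pi.single p.1.2 1 := by
    funext a
    by_cases h1 : a = p.1.1
    · subst h1; simp [pairChar, hp]
    · by_cases h2 : a = p.1.2
      · subst h2; simp [pairChar, hp, Ne.symm hp]
      · simp [pairChar, hp, h1, h2]
  rw [this, add_dotProduct, single_one_dotProduct, single_one_dotProduct]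

lemma pairShift_some_dotProduct (p : {p : Fin k × Fin k // p.1 ≤ p.2})
    (v : Fin k → ZMod 2) : pairShift (some p) ⬝ᵥ v = v p.1.1 := by
  simp [pairShift]

lemma exists_ne_three (hk : 4 ≤ k) (a b c : Fin k) : ∃ d, d ≠ a ∧ d ≠ b ∧ d ≠ c := by
  have : (({a, b, c} : Finset (Fin k))ᶜ).Nonempty := by
    rw [← Finset.card_pos, Finset.card_compl, Fintype.card_fin]
    have := Finset.card_le_three (a := a) (b := b) (c := c)
    omega
  obtain ⟨d, hd⟩ := this
  simp only [Finset.mem_compl, Finset.mem_insert, Finset.mem_singleton, not_or] at hd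
  exact ⟨d, hd⟩

lemma pairChar_injective (hk : 4 ≤ k) (o : Fin k) :
    Function.Injective (pairChar o) := by
  have h1 (p : {p : Fin k × Fin k // p.1 ≤ p.2}) :
      pairChar o none ≠ pairChar o (some p) := by
    obtain ⟨⟨i, j⟩, hij⟩ := p
    intro h
    by_cases hd : i = j
    · subst hd
      obtain ⟨d, hdo, hdi, -⟩ := exists_ne_three hk o i i
      have := congrFun h d
      simp [pairChar, hdo, hdi] at this
    · have hi := congrFun h i
      have hj := congrFun h j
      simp [pairChar, hd] at hi hj
      exact hd (hi.trans hj.symm)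
  rintro (_ | p) (_ | q) h
  · rfl
  · exact absurd h (h1 q)
  · exact absurd h.symm (h1 p)
  · obtain ⟨⟨i, j⟩, hij⟩ := p
    obtain ⟨⟨a, b⟩, hab⟩ := q
    by_cases hd : i = j <;> by_cases he : a = b
    · subst hd; subst he
      have := congrFun h i
      simp [pairChar] at this
      simp [this]
    · subst hd
      obtain ⟨d, hdo, hdi, hdb⟩ := exists_ne_three hk i a b
      have := congrFun h d
      simp [pairChar, he, hdo, hdi, hdb] at this
    · subst he
      obtain ⟨d, hdo, hdi, hdb⟩ := exists_ne_three hk i a j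
      have := congrFun h d
      simp [pairChar, hd, hdo, hdi, hdb] at this
    · have e1 := congrFun h i
      have e2 := congrFun h j
      simp [pairChar, hd, he, ← or_iff_not_imp_left] at e1 e2
      simp only at hij hab
      have : i = a ∧ j = b := by
        rcases e1 with rfl | rfl
        · rcases e2 with rfl | rfl
          · exact absurd rfl hd
          · exact ⟨rfl, rfl⟩
        · rcases e2 with rfl | rfl
          · exact absurd (le_antisymm hij hab) hd
          · exact absurd rfl hd
      obtain ⟨rfl, rfl⟩ := this
      rfl

/-- The forms `x_o + xᵢ` vanish together only on constant vectors, and the extra character `x_o`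
excludes the all-ones vector. -/
lemma separates_pairChar (o : Fin k) (ho : ∀ i, o ≤ i) : Separates (pairChar o) := by
  intro v hv
  have h0 : v o = 0 := by simpa only [pairChar_none_dotProduct] using hv none
  funext i
  by_cases hi : o = i
  · subst hi; exact h0
  · have := hv (some ⟨(o, i), ho i⟩)
    rw [pairChar_some_dotProduct o hi] at this
    simpa [h0] using this

/-- A vector with two nonzero coordinates is covered by that pair, a unit vector `eᵢ` by `(i, i)`.
-/
lemma covers_pairChar (o : Fin k) : Covers (pairChar o) pairShift := by
  intro v hv
  obtain ⟨i, hi⟩ := Function.ne_iff.1 hv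
  replace hi : v i = 1 := (ZMod.two_cases _).resolve_left hi
  by_cases h : ∃ j, j ≠ i ∧ v j = 1
  · obtain ⟨j, hj, hvj⟩ := h
    rcases lt_or_gt_of_ne hj with hlt | hlt
    · refine ⟨some ⟨(j, i), hlt.le⟩, ?_, ?_⟩
      · rw [pairChar_some_dotProduct o hlt.ne]
        simp only [hi, hvj]; rfl
      · rw [pairShift_some_dotProduct]; exact hvj
    · refine ⟨some ⟨(i, j), hlt.le⟩, ?_, ?_⟩
      · rw [pairChar_some_dotProduct o hlt.ne]
        simp only [hi, hvj]; rfl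
      · rw [pairShift_some_dotProduct]; exact hi
  · push Not at h
    have hv' : v = Pi.single i 1 := by
      funext j
      by_cases hj : j = i
      · subst hj; simp [hi]
      · simp [hj, (ZMod.two_cases _).resolve_right (h j hj)]
    refine ⟨some ⟨(i, i), le_rfl⟩, ?_, ?_⟩
    · rw [hv', dotProduct_single_one]; simp [pairChar]
    · rw [pairShift_some_dotProduct]; exact hi

/-- The private vector is `eᵢ` for `(i, i)` and `eᵢ + eⱼ` for `i < j`. -/
lemma exists_isPrivateVector_pairChar (o : Fin k)
    (p : {p : Fin k × Fin k // p.1 ≤ p.2}) :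
    ∃ v, IsPrivateVector (pairChar o) pairShift (some p) v := by
  obtain ⟨⟨i, j⟩, hij⟩ := p
  simp only at hij
  by_cases hd : i = j
  · subst hd
    refine ⟨Pi.single i 1, ?_, ?_, ?_⟩
    · rw [dotProduct_single_one]; simp [pairChar]
    · simp [pairShift]
    · rintro (_ | ⟨⟨a, b⟩, hab⟩) hne hc
      · simp [pairShift]
      · rw [pairShift_some_dotProduct]
        simp only
        by_cases ha : a = i
        · subst ha
          by_cases hb : a = b
          · subst hb; exact absurd rfl hne
          · rw [dotProduct_single_one] at hc
            simp [pairChar, hb] at hc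
        · simp [ha]
  · refine ⟨Pi.single i 1 + Pi.single j 1, ?_, ?_, ?_⟩
    · rw [pairChar_some_dotProduct o hd]
      simp [hd, Ne.symm hd]; rfl
    · rw [pairShift_some_dotProduct]; simp [hd]
    · rintro (_ | ⟨⟨a, b⟩, hab⟩) hne hc
      · simp [pairShift]
      · rw [pairShift_some_dotProduct]
        simp only at hab ⊢
        by_cases hb : a = b
        · subst hb
          rw [dotProduct_add, dotProduct_single_one, dotProduct_single_one] at hc
          by_cases ha : a = i
          · subst ha; simp [pairChar, Ne.symm hd] at hc
          · by_cases ha' : a = j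
            · subst ha'; simp [pairChar, hd] at hc
            · simp [ha, ha']
        · rw [pairChar_some_dotProduct o hb] at hc
          by_contra hva
          have h1 : a = i ∨ a = j := by
            by_contra! h; apply hva; simp [h.1, h.2]
          have h2 : b = i ∨ b = j := by
            by_contra! h
            apply hva
            simp only [Pi.add_apply] at hc ⊢
            simpa [Pi.single_apply, h.1, h.2] using hc
          apply hne
          rcases h1 with rfl | rfl <;> rcases h2 with rfl | rfl
          · exact absurd rfl hb
          · rfl
          · exact absurd (le_antisymm hij hab) hd
          · exact absurd rfl hb

lemma choose_le_of_diagonalVasquezProperty (hk : 4 ≤ k) {N : ℕ}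
    (hN : DiagonalVasquezProperty (ElementaryTwoGroup k) N) : (k + 1).choose 2 ≤ N := by
  have h := card_le_of_diagonalVasquezProperty' (pairChar_injective hk ⟨0, by omega⟩)
    (separates_pairChar _ fun i => Fin.mk_le_of_le_val (Nat.zero_le _))
    (covers_pairChar _) (P := Finset.univ.map Function.Embedding.some) (by
      intro i hi
      obtain ⟨p, -, rfl⟩ := Finset.mem_map.1 hi
      exact exists_isPrivateVector_pairChar _ p) hN
  rwa [Finset.card_map, Finset.card_univ, ← Fintype.card_congr Sym2.sortEquiv, Sym2.card,
    Fintype.card_fin] at h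

end pairFamily

/-! ### Twisted coordinates and quotients by projection -/

/-- A coordinate `t` of a group over `C₂ᵏ`: a crossed homomorphism for the character `χ` whose
value at `γ` is half of `s(π γ)` modulo `ℤ`. -/
structure IsTwist {Γ : Type*} [Group Γ] {k : ℕ} (π : Γ →* ElementaryTwoGroup k)
    (χ s : Fin k → ZMod 2) (t : Γ → ℝ) : Prop where
  map_mul : ∀ γ δ, t (γ * δ) = t γ + zsign (χ ⬝ᵥ (π γ).toAdd) * t δ
  exists_int : ∀ γ, ∃ z : ℤ, t γ = halfRep (s ⬝ᵥ (π γ).toAdd) + z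

lemma IsTwist.add {Γ : Type*} [Group Γ] {k : ℕ} {π : Γ →* ElementaryTwoGroup k}
    {χ s s' : Fin k → ZMod 2} {t t' : Γ → ℝ} (h : IsTwist π χ s t) (h' : IsTwist π χ s' t') :
    IsTwist π χ (s + s') (t + t') where
  map_mul γ δ := by
    simp only [Pi.add_apply, h.map_mul γ δ, h'.map_mul γ δ]
    ring
  exists_int γ := by
    obtain ⟨z, hz⟩ := h.exists_int γ
    obtain ⟨z', hz'⟩ := h'.exists_int γ
    obtain ⟨c, hc⟩ := exists_halfRep_add (s ⬝ᵥ (π γ).toAdd) (s' ⬝ᵥ (π γ).toAdd) 0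
    rw [zsign_zero] at hc
    refine ⟨z + z' + c, ?_⟩
    rw [Pi.add_apply, hz, hz', add_dotProduct]
    push_cast at hc ⊢
    linarith

section quotient

variable {Γ : Type*} [Group Γ] {k : ℕ} {π : Γ →* ElementaryTwoGroup k}

/-- The twists assemble into a homomorphism to `Isom(𝔼ᵐ)`. Its image is the full diagonal group
because lattice elements realize all integral shifts. Its kernel consists of lattice elements by
`Covers`: off `π.ker` some coordinate is a proper half-integer, hence nonzero. -/
lemma exists_quotient_equiv_diagonalGroup {m : ℕ} {χ s : Fin m → Fin k → ZMod 2}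
    {t : Fin m → Γ → ℝ} (hπ : Function.Surjective π) (ht : ∀ j, IsTwist π (χ j) (s j) (t j))
    (hz : ∀ z : Fin m → ℤ, ∃ γ, π γ = 1 ∧ ∀ j, t j γ = z j) (hc : Covers χ s) :
    ∃ (M : Subgroup Γ) (_ : M.Normal), M ≤ π.ker ∧ Nonempty (Γ ⧸ M ≃* diagonalGroup χ s) := by
  let Φ : Γ →* EuclideanIsom m := MonoidHom.mk'
    (fun γ => signedIsom (fun j => χ j ⬝ᵥ (π γ).toAdd) fun j => t j γ) (by
      intro γ δ
      rw [signedIsom_mul]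
      congr 1
      · funext j; simp [dotProduct_add]
      · funext j; exact (ht j).map_mul γ δ)
  have hΦ (γ : Γ) : Φ γ = signedIsom (fun j => χ j ⬝ᵥ (π γ).toAdd) fun j => t j γ := rfl
  have hr : Φ.range = diagonalGroup χ s := by
    ext A
    constructor
    · rintro ⟨γ, rfl⟩
      choose z hz using fun j => (ht j).exists_int γ
      refine ⟨(π γ).toAdd, z, ?_⟩
      rw [hΦ]
      congr 1
      funext j
      exact hz j
    · rintro ⟨g, z, rfl⟩
      obtain ⟨γ, hγ⟩ := hπ (Multiplicative.ofAdd g)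
      choose w hw using fun j => (ht j).exists_int γ
      obtain ⟨δ, hδ, hδ'⟩ := hz (z - w)
      refine ⟨δ * γ, ?_⟩
      rw [hΦ, map_mul, hδ, one_mul, hγ]
      congr 1
      funext j
      rw [(ht j).map_mul, hδ, hδ', hw, hγ]
      simp
      ring
  refine ⟨Φ.ker, inferInstance, ?_, ⟨(QuotientGroup.quotientKerEquivRange Φ).trans
    (MulEquiv.subgroupCongr hr)⟩⟩
  intro γ hγ
  rw [MonoidHom.mem_ker, hΦ, ← signedIsom_zero_zero] at hγ
  obtain ⟨-, h2⟩ := signedIsom_injective hγ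
  rw [MonoidHom.mem_ker, ← toAdd_eq_zero]
  by_contra h
  obtain ⟨j, -, hj⟩ := hc _ h
  obtain ⟨z, hz⟩ := (ht j).exists_int γ
  have h3 : halfRep 1 + z = halfRep 0 + (0 : ℤ) := by
    have : t j γ = 0 := congrFun h2 j
    rw [hj, this] at hz
    simpa using hz.symm
  exact one_ne_zero (halfRep_add_int_injective h3).1

/-- The indices in `J` suffice for `Covers`. -/
def CoversOn {ι : Type*} (χ s : ι → Fin k → ZMod 2) (J : Finset ι) : Prop :=
  ∀ v, v ≠ 0 → ∃ i ∈ J, χ i ⬝ᵥ v = 0 ∧ s i ⬝ᵥ v = 1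

/-- The indices in `J` suffice for `Separates`. -/
def SeparatesOn {ι : Type*} (χ : ι → Fin k → ZMod 2) (J : Finset ι) : Prop :=
  ∀ v, (∀ i ∈ J, χ i ⬝ᵥ v = 0) → v = 0

variable {n : ℕ} {χ s : Fin n → Fin k → ZMod 2} {t : Fin n → Γ → ℝ}

/-- The second alternative in `hJ` admits a quotient without holonomy, whose lattice is `½ℤ` in each
coordinate of `J`. -/
lemma exists_diagonal_quotient (hπ : Function.Surjective π)
    (ht : ∀ j, IsTwist π (χ j) (s j) (t j))
    (hz : ∀ z : Fin n → ℤ, ∃ γ, π γ = 1 ∧ ∀ j, t j γ = z j) {J : Finset (Fin n)}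
    (hc : CoversOn χ s J)
    (hJ : SeparatesOn χ J ∨ (∀ i ∈ J, χ i = 0) ∧
      ∀ w : Fin n → ZMod 2, ∃ g, ∀ i ∈ J, s i ⬝ᵥ g = w i) :
    ∃ (M : Subgroup Γ) (_ : M.Normal), M ≤ π.ker ∧
      IsDiagonalBieberbachOfDim (Γ ⧸ M) J.card := by
  let e := J.equivFin.symm
  have hc' : Covers (fun j => χ (e j)) fun j => s (e j) := by
    intro v hv
    obtain ⟨i, hi, h⟩ := hc v hv
    exact ⟨e.symm ⟨i, hi⟩, by simpa using h⟩
  obtain ⟨M, hM, hle, hq⟩ := exists_quotient_equiv_diagonalGroup hπ (fun j => ht (e j))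
    (fun z => by
      obtain ⟨γ, hγ, h⟩ := hz fun i => if hi : i ∈ J then z (e.symm ⟨i, hi⟩) else 0
      exact ⟨γ, hγ, fun j => by rw [h]; simp⟩) hc'
  refine ⟨M, hM, hle, _, isBieberbachGroup_diagonalGroup hc', ?_, hq⟩
  rcases hJ with hJ | ⟨h0, hw⟩
  · refine hasDiagonalHolonomy_diagonalGroup fun v hv => hJ v fun i hi => ?_
    simpa using hv (e.symm ⟨i, hi⟩)
  · refine hasDiagonalHolonomy_diagonalGroup_of_trivial (fun j => h0 _ (e j).2) fun w => ?_
    obtain ⟨g, hg⟩ := hw fun i => if hi : i ∈ J then w (e.symm ⟨i, hi⟩) else 0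
    exact ⟨g, fun j => by rw [hg _ (e j).2]; simp⟩

/-- Coordinates with equal characters may be added; with `exists_lattice_update_add` this is a
unimodular change of lattice coordinates that enlarges the choice of forms `s`. -/
lemma IsTwist.update_add (ht : ∀ j, IsTwist π (χ j) (s j) (t j)) {u v : Fin n}
    (huv : χ u = χ v) (j : Fin n) :
    IsTwist π (χ j) (Function.update s u (s u + s v) j) (Function.update t u (t u + t v) j) := by
  by_cases hj : j = u
  · subst hj
    simpa using (ht j).add (huv ▸ ht v)
  · simpa [hj] using ht j

lemma exists_lattice_update_add (hz : ∀ z : Fin n → ℤ, ∃ γ, π γ = 1 ∧ ∀ j, t j γ = z j)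
    {u v : Fin n} (huv : u ≠ v) (z : Fin n → ℤ) :
    ∃ γ, π γ = 1 ∧ ∀ j, Function.update t u (t u + t v) j γ = z j := by
  obtain ⟨γ, hγ, h⟩ := hz (Function.update z u (z u - z v))
  refine ⟨γ, hγ, fun j => ?_⟩
  by_cases hj : j = u
  · subst hj
    simp [h, Ne.symm huv]
  · simp [hj, h]

end quotient

/-! ### Forms attached to a Bieberbach group of diagonal type -/

lemma exists_dotProduct_of_additive {Γ : Type*} [Group Γ] {k : ℕ} {π : Γ →* ElementaryTwoGroup k}
    (hπ : Function.Surjective π) {h : Γ → ZMod 2} (hm : ∀ γ δ, h (γ * δ) = h γ + h δ)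
    (hk : ∀ γ, π γ = 1 → h γ = 0) :
    ∃ x : Fin k → ZMod 2, ∀ γ, x ⬝ᵥ (π γ).toAdd = h γ := by
  have hw {γ δ : Γ} (e : π γ = π δ) : h γ = h δ := by
    have h1 := hk (γ * δ⁻¹) (by rw [map_mul, map_inv, e, mul_inv_cancel])
    have h2 := hm (γ * δ⁻¹) δ
    rwa [inv_mul_cancel_right, h1, zero_add] at h2
  let σ := Function.surjInv hπ
  have hσ (v) : π (σ v) = v := Function.surjInv_eq hπ v
  let f : (Fin k → ZMod 2) →+ ZMod 2 := AddMonoidHom.mk' (fun v => h (σ (Multiplicative.ofAdd v)))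
    fun v w => by rw [← hm]; exact hw (by rw [map_mul, hσ, hσ, hσ]; rfl)
  refine ⟨fun i => f (Pi.single i 1), fun γ => ?_⟩
  have h1 := LinearMap.pi_apply_eq_sum_univ (f.toZModLinearMap 2) (π γ).toAdd
  have h2 : h γ = f (π γ).toAdd := hw (by rw [hσ]; rfl)
  rw [h2]
  refine Eq.trans ?_ h1.symm
  refine Finset.sum_congr rfl fun i _ => ?_
  rw [smul_eq_mul, mul_comm]
  congr 2
  change f _ = f _
  congr 1
  funext j
  simp [Pi.single_apply, eq_comm]

/-- Coordinates for a Bieberbach group of diagonal type: after a change of origin, all translation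
parts lie in `½ℤⁿ`. -/
lemma exists_twists {n k : ℕ} {Γ : Subgroup (EuclideanIsom n)} (hB : IsBieberbachGroup Γ)
    (hD : HasDiagonalHolonomy Γ) (φ : holonomyGroup Γ ≃* ElementaryTwoGroup k) :
    ∃ (π : Γ →* ElementaryTwoGroup k) (χ s : Fin n → Fin k → ZMod 2) (t : Fin n → Γ → ℝ),
      Function.Surjective π ∧ π.ker = latticeSubgroup Γ ∧
      (∀ j, IsTwist π (χ j) (s j) (t j)) ∧
      (∀ z : Fin n → ℤ, ∃ γ, π γ = 1 ∧ ∀ j, t j γ = z j) ∧ Covers χ s ∧ Separates χ := by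
  obtain ⟨b, hb, hh⟩ := hD
  let π : Γ →* ElementaryTwoGroup k := φ.toMonoidHom.comp (holonomyHom Γ).rangeRestrict
  have hπ : Function.Surjective π := φ.surjective.comp (holonomyHom Γ).rangeRestrict_surjective
  have hπ1 (γ : Γ) : π γ = 1 ↔ holonomyHom Γ γ = 1 := by
    change φ _ = 1 ↔ _
    rw [MulEquiv.map_eq_one_iff, Subtype.ext_iff]
    rfl
  let a (i : Fin n) (γ : Γ) : ZMod 2 := open Classical in
    if holonomyHom Γ γ (b i) = b i then 0 else 1
  have ha (i : Fin n) (γ : Γ) : holonomyHom Γ γ (b i) = (zsign (a i γ) : ℝ) • b i := by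
    by_cases h : holonomyHom Γ γ (b i) = b i
    · simp [a, h]
    · have := (hh _ (⟨γ, rfl⟩ : holonomyHom Γ γ ∈ holonomyGroup Γ) i).resolve_left h
      simp [a, h]
      exact this
  have ham (i : Fin n) (γ δ : Γ) : a i (γ * δ) = a i γ + a i δ := by
    apply zsign_injective
    have h1 : holonomyHom Γ (γ * δ) (b i) = holonomyHom Γ γ (holonomyHom Γ δ (b i)) := by
      rw [map_mul]; rfl
    rw [ha, ha, map_smul, ha, smul_smul] at h1
    have h2 := smul_left_injective ℝ (b.ne_zero i) h1
    rw [zsign_add, mul_comm]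
    exact_mod_cast h2
  have hrepr (i : Fin n) (γ : Γ) (x : EuclideanSpace ℝ (Fin n)) :
      b.repr (holonomyHom Γ γ x) i = zsign (a i γ) * b.repr x i := by
    have : (b.coord i).comp (holonomyHom Γ γ).toLinearEquiv.toLinearMap =
        (zsign (a i γ) : ℝ) • b.coord i := by
      refine b.ext fun j => ?_
      change b.repr (holonomyHom Γ γ (b j)) i = (zsign (a i γ) : ℝ) * b.repr (b j) i
      rw [ha, map_smul]
      by_cases hij : j = i
      · subst hij; simp
      · simp [hij]
    exact LinearMap.congr_fun this x
  let τ (i : Fin n) (γ : Γ) : ℝ := b.repr ((γ : EuclideanIsom n) 0) i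
  have hτm (i : Fin n) (γ δ : Γ) : τ i (γ * δ) = τ i γ + zsign (a i γ) * τ i δ := by
    simp only [τ]
    rw [Subgroup.coe_mul, AffineIsometryEquiv.coe_mul, Function.comp_apply,
      EuclideanIsom.apply_eq, map_add, Finsupp.add_apply, add_comm, ← hrepr]
    rfl
  have hτl (γ : Γ) (h : holonomyHom Γ γ = 1) (i : Fin n) : ∃ z : ℤ, τ i γ = z := by
    have h1 := SetLike.coe_mem γ
    rw [EuclideanIsom.coe_eq_constVAdd h, hb, Module.Basis.mem_span_iff_repr_mem] at h1
    obtain ⟨z, hz⟩ := h1 i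
    exact ⟨z, hz.symm⟩
  have ha1 (γ : Γ) (h : holonomyHom Γ γ = 1) (i : Fin n) : a i γ = 0 := by simp [a, h]
  have hτ0 (i : Fin n) (γ : Γ) (h : a i γ = 0) : ∃ z : ℤ, 2 * τ i γ = z := by
    obtain ⟨z, hz⟩ := hτl _ (EuclideanIsom.sq_linear_eq_one hh γ) i
    refine ⟨z, ?_⟩
    rw [← hz, pow_two, hτm, h, zsign_zero]
    push_cast; ring
  -- If some `δ` reflects coordinate `i`, the new origin is its fixed point `τ i δ / 2`. Any other
  -- `γ` reflecting it differs from `δ` by the unreflected `γδ`, whose translation part is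
  -- half-integral.
  have ho (i : Fin n) : ∃ o : ℝ, ∀ γ, a i γ = 1 → ∃ z : ℤ, 2 * (τ i γ - 2 * o) = z := by
    by_cases h : ∃ δ, a i δ = 1
    · obtain ⟨δ, hδ⟩ := h
      refine ⟨τ i δ / 2, fun γ hγ => ?_⟩
      obtain ⟨z, hz⟩ := hτ0 i (γ * δ) (by rw [ham, hγ, hδ]; rfl)
      refine ⟨z, ?_⟩
      rw [← hz, hτm, hγ, zsign_one]
      push_cast; ring
    · exact ⟨0, fun γ hγ => absurd ⟨γ, hγ⟩ h⟩
  choose o ho using ho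
  let t (i : Fin n) (γ : Γ) : ℝ := τ i γ - (1 - zsign (a i γ)) * o i
  have htm (i : Fin n) (γ δ : Γ) : t i (γ * δ) = t i γ + zsign (a i γ) * t i δ := by
    simp only [t, hτm, ham, zsign_add]
    push_cast; ring
  have hw (i : Fin n) (γ : Γ) : ∃ w : ℤ, 2 * t i γ = w := by
    rcases ZMod.two_cases (a i γ) with h | h
    · obtain ⟨z, hz⟩ := hτ0 i γ h
      exact ⟨z, by simp only [t, h, zsign_zero]; push_cast; linarith⟩
    · obtain ⟨z, hz⟩ := ho i γ h
      exact ⟨z, by simp only [t, h, zsign_one]; push_cast; linarith⟩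
  choose w hw using hw
  have htl (γ : Γ) (h : holonomyHom Γ γ = 1) (i : Fin n) : t i γ = τ i γ := by
    simp [t, ha1 γ h i]
  have hwm (i : Fin n) (γ δ : Γ) :
      ((w i (γ * δ) : ℤ) : ZMod 2) = (w i γ : ZMod 2) + (w i δ : ZMod 2) := by
    have h1 : w i (γ * δ) = w i γ + zsign (a i γ) * w i δ := by
      have : (w i (γ * δ) : ℝ) = w i γ + zsign (a i γ) * w i δ := by
        rw [← hw, ← hw, ← hw, htm]; ring
      exact_mod_cast this
    rw [h1]
    rcases zsign_cases (a i γ) with h | h <;> rw [h] <;> push_cast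
    · rw [one_mul]
    · rw [neg_one_mul, CharTwo.neg_eq]
  choose χ hχ using fun i => exists_dotProduct_of_additive hπ (ham i)
    fun γ h => ha1 γ ((hπ1 γ).1 h) i
  choose s hs using fun i => exists_dotProduct_of_additive (h := fun γ => (w i γ : ZMod 2)) hπ (hwm i) fun γ h => by
    obtain ⟨z, hz⟩ := hτl γ ((hπ1 γ).1 h) i
    have h1 : w i γ = 2 * z := by
      have : (w i γ : ℝ) = 2 * z := by rw [← hw, htl γ ((hπ1 γ).1 h), hz]
      exact_mod_cast this
    simp only [h1]
    push_cast
    rw [show (2 : ZMod 2) = 0 from rfl, zero_mul]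
  have htw (j : Fin n) : IsTwist π (χ j) (s j) (t j) := by
    refine ⟨fun γ δ => by rw [hχ, htm], fun γ => ⟨w j γ / 2, ?_⟩⟩
    rw [hs]
    have h2 := two_mul_halfRep (w j γ : ZMod 2)
    have h3 : (((w j γ : ZMod 2).val : ℕ) : ℤ) = w j γ % 2 := by
      rw [ZMod.val_intCast]; rfl
    rw [h3] at h2
    have h4 : (((w j γ % 2 + 2 * (w j γ / 2) : ℤ)) : ℝ) = w j γ := by rw [Int.emod_add_mul_ediv]
    have h5 := hw j γ
    push_cast at h4
    linarith
  have hlat (z : Fin n → ℤ) : ∃ γ, π γ = 1 ∧ ∀ j, t j γ = z j := by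
    let x : EuclideanSpace ℝ (Fin n) := b.equivFun.symm fun i => (z i : ℝ)
    have hx (i : Fin n) : b.repr x i = z i := by
      rw [← b.equivFun_apply, LinearEquiv.apply_symm_apply]
    have hxm : AffineIsometryEquiv.constVAdd ℝ (EuclideanSpace ℝ (Fin n)) x ∈ Γ := by
      rw [hb, Module.Basis.mem_span_iff_repr_mem]
      exact fun i => ⟨z i, (hx i).symm⟩
    have h1 : holonomyHom Γ ⟨_, hxm⟩ = 1 := by
      refine LinearIsometryEquiv.ext fun y => ?_
      have := EuclideanIsom.apply_eq
        (AffineIsometryEquiv.constVAdd ℝ (EuclideanSpace ℝ (Fin n)) x) y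
      simp only [AffineIsometryEquiv.coe_constVAdd, vadd_eq_add, add_zero] at this
      rw [add_comm] at this
      exact (add_right_cancel this).symm
    refine ⟨⟨_, hxm⟩, (hπ1 _).2 h1, fun j => ?_⟩
    rw [htl _ h1, ← hx j]
    simp [τ]
  refine ⟨π, χ, s, t, hπ, ?_, htw, hlat, ?_, ?_⟩
  · ext γ
    exact hπ1 γ
  · intro p hp
    by_contra! hcon
    obtain ⟨γ₀, hγ₀⟩ := hπ (Multiplicative.ofAdd p)
    choose z hz using fun i => (htw i).exists_int γ₀
    -- Correcting the lift by a lattice element removes its integral parts. If no index covers `p`,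
    -- the unreflected coordinates become zero, so the square is trivial, against torsion-freeness.
    obtain ⟨l, hl, hlt⟩ := hlat (-z)
    have hγ : π (l * γ₀) = Multiplicative.ofAdd p := by rw [map_mul, hl, one_mul, hγ₀]
    have hsq0 (i : Fin n) : t i ((l * γ₀) ^ 2) = 0 := by
      rw [pow_two, (htw i).map_mul, hγ, toAdd_ofAdd]
      rcases ZMod.two_cases (χ i ⬝ᵥ p) with h | h
      · have h1 := (ZMod.two_cases _).resolve_right (hcon i h)
        have h2 : t i (l * γ₀) = 0 := by
          rw [(htw i).map_mul, hl, hlt, hz, hγ₀, toAdd_ofAdd, h1]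
          simp
        rw [h2]; simp
      · rw [h]; simp
    have h1 := EuclideanIsom.sq_linear_eq_one hh (l * γ₀)
    have h2 : (((l * γ₀) ^ 2 : Γ) : EuclideanIsom n) 0 = 0 := by
      apply b.repr.injective
      ext i
      exact (htl _ h1 i).symm.trans ((hsq0 i).trans (by simp))
    have h3 : ((l * γ₀ : Γ) : EuclideanIsom n) ^ 2 = 1 := by
      rw [← Subgroup.coe_pow, EuclideanIsom.coe_eq_constVAdd h1, h2]
      exact AffineIsometryEquiv.ext fun x => by simp
    have h4 : l * γ₀ = 1 := Subtype.ext <| hB.torsion_free _ (SetLike.coe_mem _)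
      (isOfFinOrder_iff_pow_eq_one.2 ⟨2, two_pos, h3⟩)
    rw [h4, map_one] at hγ
    exact hp (congrArg Multiplicative.toAdd hγ).symm
  · intro v hv
    obtain ⟨γ, hγ⟩ := hπ (Multiplicative.ofAdd v)
    have h1 : holonomyHom Γ γ = 1 := by
      refine LinearIsometryEquiv.toLinearEquiv_injective (LinearEquiv.toLinearMap_injective
        (b.ext fun i => ?_))
      change (holonomyHom Γ γ) (b i) = b i
      rw [ha, ← hχ, hγ, toAdd_ofAdd, hv]
      simp
    rw [(hπ1 γ).2 h1] at hγ
    exact (congrArg Multiplicative.toAdd hγ).symm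

/-! ### Small covering and separating sets -/

section selection

variable {k : ℕ} {ι : Type*} {χ s : ι → Fin k → ZMod 2}

/-- Any set of indices can be completed to a separating one by indices whose characters have a
dual family killed by the given characters. -/
lemma exists_separating_extension [Finite ι] [DecidableEq ι] (hs : Separates χ) (J : Finset ι) :
    ∃ (T : Finset ι) (g : ι → Fin k → ZMod 2), SeparatesOn χ (J ∪ T) ∧
      (∀ t ∈ T, ∀ j ∈ J, χ j ⬝ᵥ g t = 0) ∧ (∀ t ∈ T, χ t ⬝ᵥ g t = 1) ∧
      ∀ t ∈ T, ∀ t' ∈ T, t' ≠ t → χ t' ⬝ᵥ g t = 0 := by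
  have := Fintype.ofFinite ι
  have : DecidablePred fun T : Finset ι => SeparatesOn χ (J ∪ T) := Classical.decPred _
  -- By minimality, dropping `t` from `T` destroys separation, and a vector witnessing this is the
  -- dual vector `g t`.
  obtain ⟨T, hT, hmin⟩ := Finset.exists_min_image
    (Finset.univ.filter fun T : Finset ι => SeparatesOn χ (J ∪ T)) Finset.card
    ⟨Finset.univ, by simpa [SeparatesOn, Separates] using hs⟩
  simp only [Finset.mem_filter, Finset.mem_univ, true_and] at hT hmin
  have key (t : ι) : ∃ g : Fin k → ZMod 2, t ∈ T → χ t ⬝ᵥ g = 1 ∧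
      ∀ i ∈ J ∪ T.erase t, χ i ⬝ᵥ g = 0 := by
    by_cases ht : t ∈ T
    · have h1 : ¬ SeparatesOn χ (J ∪ T.erase t) := fun h => by
        have := hmin _ h
        have := Finset.card_erase_lt_of_mem ht
        omega
      unfold SeparatesOn at h1
      push Not at h1
      obtain ⟨g, hg, hg0⟩ := h1
      refine ⟨g, fun _ => ⟨(ZMod.two_cases _).resolve_left fun h => hg0 (hT g fun i hi => ?_), hg⟩⟩
      by_cases hit : i = t
      · rw [hit]; exact h
      · apply hg
        simp only [Finset.mem_union, Finset.mem_erase] at hi ⊢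
        tauto
    · exact ⟨0, fun h => absurd h ht⟩
  choose g hg using key
  refine ⟨T, g, hT, fun t ht j hj => (hg t ht).2 j (Finset.mem_union_left _ hj),
    fun t ht => (hg t ht).1, fun t ht t' ht' hne => (hg t ht).2 t'
      (Finset.mem_union_right _ (Finset.mem_erase.2 ⟨hne, ht'⟩))⟩

lemma linearIndependent_of_dual {T : Finset ι} {g : ι → Fin k → ZMod 2}
    (h1 : ∀ t ∈ T, χ t ⬝ᵥ g t = 1) (h0 : ∀ t ∈ T, ∀ t' ∈ T, t' ≠ t → χ t' ⬝ᵥ g t = 0) :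
    LinearIndependent (ZMod 2) fun t : T => g t := by
  refine LinearIndependent.of_pairwise_dual_eq_zero_one _
    (fun t : T => dotProductBilin (ZMod 2) (ZMod 2) (χ t)) ?_ fun t => h1 t t.2
  intro t t' hne
  exact h0 t' t'.2 t t.2 fun h => hne (Subtype.ext h)

lemma eq_zero_of_card_ge {T : Finset ι} {g : ι → Fin k → ZMod 2}
    (hg : LinearIndependent (ZMod 2) fun t : T => g t) (hT : k ≤ T.card) {x : Fin k → ZMod 2}
    (hx : ∀ t ∈ T, x ⬝ᵥ g t = 0) : x = 0 := by
  have htop := hg.span_eq_top_of_card_eq_finrank' (by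
    have := hg.fintype_card_le_finrank
    simp at this ⊢
    omega)
  refine dotProduct_eq_zero _ fun w => ?_
  have : w ∈ Submodule.span (ZMod 2) (Set.range fun t : T => g t) := htop ▸ Submodule.mem_top
  induction this using Submodule.span_induction with
  | mem y hy => obtain ⟨t, rfl⟩ := hy; exact hx t t.2
  | zero => exact dotProduct_zero _
  | add y z _ _ hy hz => rw [dotProduct_add, hy, hz, add_zero]
  | smul c y _ hy => rw [dotProduct_smul, hy, smul_zero]

lemma card_le_of_linearIndependent {T : Finset ι} {g : ι → Fin k → ZMod 2}
    (hg : LinearIndependent (ZMod 2) fun t : T => g t) : T.card ≤ k := by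
  simpa using hg.fintype_card_le_finrank

/-- If no character of a covering set vanishes, at most `k - 2` further indices are needed to
separate. -/
lemma card_add_two_le {J T : Finset ι} {g : ι → Fin k → ZMod 2} (hk : 0 < k)
    (hg : LinearIndependent (ZMod 2) fun t : T => g t) (hc : CoversOn χ s J)
    (hJ : ∀ j ∈ J, χ j ≠ 0) (h0 : ∀ t ∈ T, ∀ j ∈ J, χ j ⬝ᵥ g t = 0) : T.card + 2 ≤ k := by
  by_contra! hcon
  by_cases htop : Submodule.span (ZMod 2) (Set.range fun t : T => g t) = ⊤
  · obtain ⟨j, hj, -⟩ := hc (Pi.single ⟨0, hk⟩ 1) (by simp)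
    refine hJ j hj (eq_zero_of_card_ge hg ?_ fun t ht => h0 t ht j hj)
    have := finrank_span_eq_card hg
    rw [htop] at this
    simp at this
    omega
  -- Here the `g t` span a hyperplane killed by every character of `J`. The index covering a vector
  -- outside it has a character that vanishes everywhere.
  · obtain ⟨v, hv⟩ : ∃ v, v ∉ Submodule.span (ZMod 2) (Set.range fun t : T => g t) := by
      by_contra! h
      exact htop (eq_top_iff.2 fun v _ => h v)
    have hv0 : v ≠ 0 := fun h => hv (h ▸ Submodule.zero_mem _)
    obtain ⟨j, hj, hjv, -⟩ := hc v hv0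
    have hli : LinearIndependent (ZMod 2)
        fun o : Option T => Option.casesOn' o v fun t : T => g t := hg.option hv
    have htop' := hli.span_eq_top_of_card_eq_finrank' (by
      have := hli.fintype_card_le_finrank
      simp at this ⊢
      omega)
    refine hJ j hj (dotProduct_eq_zero _ fun w => ?_)
    have : w ∈ Submodule.span (ZMod 2)
        (Set.range fun o : Option T => Option.casesOn' o v fun t : T => g t) := htop' ▸ Submodule.mem_top
    induction this using Submodule.span_induction with
    | mem y hy =>
      obtain ⟨_ | t, rfl⟩ := hy
      · exact hjv
      · exact h0 t t.2 j hj
    | zero => exact dotProduct_zero _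
    | add y z _ _ hy hz => rw [dotProduct_add, hy, hz, add_zero]
    | smul c y _ hy => rw [dotProduct_smul, hy, smul_zero]

lemma CoversOn.mono {J J' : Finset ι} (h : CoversOn χ s J) (hJ : J ⊆ J') : CoversOn χ s J' :=
  fun v hv => (h v hv).imp fun _ hi => ⟨hJ hi.1, hi.2⟩

/-- The function `v ↦ (1 + χ(v)) s(v)` detecting the vectors with `χ(v) = 0` and `s(v) = 1`. -/
def coverFun (x y : Fin k → ZMod 2) : (Fin k → ZMod 2) → ZMod 2 :=
  fun v => (1 + x ⬝ᵥ v) * (y ⬝ᵥ v)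

lemma coverFun_ne_zero {x y v : Fin k → ZMod 2} :
    coverFun x y v ≠ 0 ↔ x ⬝ᵥ v = 0 ∧ y ⬝ᵥ v = 1 := by
  unfold coverFun
  generalize x ⬝ᵥ v = a
  generalize y ⬝ᵥ v = b
  revert a b; decide

/-- The quadratic functions on `𝔽₂ᵏ` vanishing at the origin. -/
def quadraticFunctions (k : ℕ) : Submodule (ZMod 2) ((Fin k → ZMod 2) → ZMod 2) :=
  Submodule.span (ZMod 2) (Set.range fun (p : Sym2 (Fin k)) (v : Fin k → ZMod 2) =>
    (p.map v).mul)

lemma finrank_quadraticFunctions_le (k : ℕ) :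
    Module.finrank (ZMod 2) (quadraticFunctions k) ≤ (k + 1).choose 2 := by
  refine (finrank_range_le_card _).trans ?_
  rw [Sym2.card, Fintype.card_fin]

lemma card_le_of_mem_quadraticFunctions {κ : Type*} [Fintype κ]
    {f : κ → (Fin k → ZMod 2) → ZMod 2} (hf : LinearIndependent (ZMod 2) f)
    (hmem : ∀ i, f i ∈ quadraticFunctions k) : Fintype.card κ ≤ (k + 1).choose 2 := by
  refine le_trans ?_ (finrank_quadraticFunctions_le k)
  rw [← finrank_span_eq_card hf]
  refine Submodule.finrank_mono (Submodule.span_le.2 ?_)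
  rintro _ ⟨i, rfl⟩
  exact hmem i

lemma mul_mem_quadraticFunctions (x y : Fin k → ZMod 2) :
    (fun v => (x ⬝ᵥ v) * (y ⬝ᵥ v)) ∈ quadraticFunctions k := by
  have : (fun v => (x ⬝ᵥ v) * (y ⬝ᵥ v)) =
      ∑ i, ∑ j, (x i * y j) • fun v : Fin k → ZMod 2 => (Sym2.map v s(i, j)).mul := by
    funext v
    simp only [dotProduct, Finset.sum_mul_sum, Finset.sum_apply, Pi.smul_apply, smul_eq_mul,
      Sym2.map_mk, Sym2.mul_mk]
    exact Finset.sum_congr rfl fun i _ => Finset.sum_congr rfl fun j _ => by ring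
  rw [this]
  exact Submodule.sum_mem _ fun i _ => Submodule.sum_mem _ fun j _ =>
    Submodule.smul_mem _ _ (Submodule.subset_span ⟨s(i, j), rfl⟩)

/-- Over `𝔽₂` a linear form equals its square, so `(1 + x)y = y² + xy` has no linear part to account
for. -/
lemma coverFun_mem_quadraticFunctions (x y : Fin k → ZMod 2) :
    coverFun x y ∈ quadraticFunctions k := by
  have : coverFun x y = (fun v => (y ⬝ᵥ v) * (y ⬝ᵥ v)) + fun v => (x ⬝ᵥ v) * (y ⬝ᵥ v) := by
    funext v
    simp only [coverFun, Pi.add_apply]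
    generalize x ⬝ᵥ v = a
    generalize y ⬝ᵥ v = b
    revert a b; decide
  rw [this]
  exact Submodule.add_mem _ (mul_mem_quadraticFunctions _ _) (mul_mem_quadraticFunctions _ _)

/-- If every function in a basis of the span vanished at `v`, so would every cover function, and `v`
would be uncovered. -/
lemma exists_covering_linearIndependent [Finite ι] (hc : Covers χ s) :
    ∃ J : Finset ι, CoversOn χ s J ∧
      LinearIndependent (ZMod 2) fun j : J => coverFun (χ j) (s j) := by
  classical
  obtain ⟨κ, a, ha, hspan, hli⟩ :=
    exists_linearIndependent' (ZMod 2) fun i => coverFun (χ i) (s i)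
  have : Finite κ := Finite.of_injective a ha
  have := Fintype.ofFinite κ
  refine ⟨Finset.univ.image a, fun v hv => ?_, ?_⟩
  · by_contra! hcon
    obtain ⟨i, hi⟩ := hc v hv
    have h1 : coverFun (χ i) (s i) ∈ Submodule.span (ZMod 2)
        (Set.range ((fun i => coverFun (χ i) (s i)) ∘ a)) :=
      hspan ▸ Submodule.subset_span ⟨i, rfl⟩
    have h2 : Submodule.span (ZMod 2) (Set.range ((fun i => coverFun (χ i) (s i)) ∘ a)) ≤
        LinearMap.ker (LinearMap.proj (R := ZMod 2) (φ := fun _ => ZMod 2) v) := by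
      rw [Submodule.span_le]
      rintro _ ⟨j, rfl⟩
      by_contra h
      obtain ⟨h3, h4⟩ := coverFun_ne_zero.1 h
      exact hcon (a j) (Finset.mem_image_of_mem _ (Finset.mem_univ _)) h3 h4
    exact coverFun_ne_zero.2 hi (h2 h1)
  · let e : κ ≃ Finset.univ.image a := Equiv.ofBijective
      (fun j => ⟨a j, Finset.mem_image_of_mem _ (Finset.mem_univ _)⟩)
      ⟨fun x y h => ha (congrArg Subtype.val h), fun ⟨y, hy⟩ => by
        obtain ⟨x, -, rfl⟩ := Finset.mem_image.1 hy
        exact ⟨x, rfl⟩⟩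
    exact (linearIndependent_equiv e).1 hli

/-- The bound by the dimension of the space of quadratic functions. -/
lemma exists_covering_separating [Finite ι] (hc : Covers χ s) (hs : Separates χ) :
    ∃ J : Finset ι, J.card ≤ (k + 1).choose 2 + 1 ∧ CoversOn χ s J ∧ SeparatesOn χ J := by
  classical
  obtain ⟨J, hJ, hli⟩ := exists_covering_linearIndependent hc
  obtain ⟨T, g, hsep, hgJ, hg1, hg0⟩ := exists_separating_extension hs J
  refine ⟨J ∪ T, (Finset.card_union_le _ _).trans ?_, hJ.mono Finset.subset_union_left, hsep⟩
  rcases T.eq_empty_or_nonempty with rfl | ⟨t₀, ht₀⟩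
  · have := card_le_of_mem_quadraticFunctions hli fun j => coverFun_mem_quadraticFunctions _ _
    simp only [Fintype.card_coe, Finset.card_empty] at this ⊢
    omega
  let q (t : T.erase t₀) : (Fin k → ZMod 2) → ZMod 2 := fun v => (χ t₀ ⬝ᵥ v) * (χ t ⬝ᵥ v)
  let ev (v : Fin k → ZMod 2) : Module.Dual (ZMod 2) ((Fin k → ZMod 2) → ZMod 2) :=
    LinearMap.proj v
  -- Polarization at `(g t₀, g t)`. Since the characters of `J` vanish on the `g t`, cover functions
  -- are additive there and `D` kills them, while the `D t` are dual to the products `q t`.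
  let D (t : T.erase t₀) : Module.Dual (ZMod 2) ((Fin k → ZMod 2) → ZMod 2) :=
    ev (g t₀ + g t) + ev (g t₀) + ev (g t)
  have hD (t : T.erase t₀) (f) : D t f = f (g t₀ + g t) + f (g t₀) + f (g t) := rfl
  have hmem (t : T.erase t₀) : (t : ι) ≠ t₀ ∧ (t : ι) ∈ T := Finset.mem_erase.1 t.2
  have hDJ (t : T.erase t₀) (j : J) : D t (coverFun (χ j) (s j)) = 0 := by
    rw [hD]
    simp only [coverFun, dotProduct_add, hgJ t₀ ht₀ j j.2, hgJ t (hmem t).2 j j.2]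
    generalize s j ⬝ᵥ g t₀ = a
    generalize s j ⬝ᵥ g t = b
    revert a b; decide
  have hDq (t : T.erase t₀) : D t (q t) = 1 := by
    rw [hD]
    simp only [q, dotProduct_add, hg1 t₀ ht₀, hg1 t (hmem t).2,
      hg0 t₀ ht₀ t (hmem t).2 (hmem t).1, hg0 t (hmem t).2 t₀ ht₀ (hmem t).1.symm]
    decide
  have hDq' : Pairwise fun t t' : T.erase t₀ => D t (q t') = 0 := by
    intro t t' hne
    have hne' : (t' : ι) ≠ t := fun h => hne (Subtype.ext h.symm)
    rw [hD]
    simp only [q, dotProduct_add, hg1 t₀ ht₀, hg0 t₀ ht₀ t' (hmem t').2 (hmem t').1,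
      hg0 t (hmem t).2 t₀ ht₀ (hmem t).1.symm, hg0 t (hmem t).2 t' (hmem t').2 hne']
    decide
  have hq := LinearIndependent.of_pairwise_dual_eq_zero_one q D hDq' hDq
  have hdisj : Disjoint (Submodule.span (ZMod 2) (Set.range fun j : J => coverFun (χ j) (s j)))
      (Submodule.span (ZMod 2) (Set.range q)) := by
    rw [Submodule.disjoint_def]
    intro x hx hx'
    have h0 (t : T.erase t₀) : D t x = 0 := by
      have : Submodule.span (ZMod 2) (Set.range fun j : J => coverFun (χ j) (s j)) ≤
          LinearMap.ker (D t) := by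
        rw [Submodule.span_le]
        rintro _ ⟨j, rfl⟩
        exact hDJ t j
      exact this hx
    obtain ⟨c, rfl⟩ := (Submodule.mem_span_range_iff_exists_fun _).1 hx'
    refine Finset.sum_eq_zero fun t _ => ?_
    have := h0 t
    rw [map_sum, Finset.sum_eq_single t, map_smul, hDq, smul_eq_mul, mul_one] at this
    · rw [this, zero_smul]
    · intro t' _ hne
      rw [map_smul, hDq' hne.symm, smul_zero]
    · simp
  have hsum := hli.sum_type hq hdisj
  have h1 := card_le_of_mem_quadraticFunctions hsum (by
    rintro (j | t)
    · exact coverFun_mem_quadraticFunctions _ _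
    · exact mul_mem_quadraticFunctions _ _)
  simp only [Fintype.card_sum, Fintype.card_coe, Finset.card_erase_of_mem ht₀] at h1
  have := Finset.card_pos.2 ⟨t₀, ht₀⟩
  omega

end selection

/-! ### Ranks two and three -/

section lowRank

variable {ι : Type*} [Finite ι]

set_option synthInstance.maxHeartbeats 400000 in
set_option synthInstance.maxSize 2000 in
lemma exists_dotProduct_eq_two : ∀ x : Fin 2 → ZMod 2, x ≠ 0 → ∀ p, x ⬝ᵥ p = 0 →
    ∀ y : Fin 2 → ZMod 2, y ⬝ᵥ p = 1 → ∀ b c, ∃ g, x ⬝ᵥ g = b ∧ y ⬝ᵥ g = c := by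
  decide

lemma exists_kernel_two : ∀ x : Fin 2 → ZMod 2, x ≠ 0 → ∃ p, p ≠ 0 ∧ x ⬝ᵥ p = 0 ∧
    ∀ v, x ⬝ᵥ v = 0 → v = 0 ∨ v = p := by
  decide

lemma exists_covering_two {χ s : ι → Fin 2 → ZMod 2} (hc : Covers χ s) (hs : Separates χ) :
    ∃ J : Finset ι, J.card ≤ 3 ∧ CoversOn χ s J ∧ (SeparatesOn χ J ∨ (∀ i ∈ J, χ i = 0) ∧
      ∀ w : ι → ZMod 2, ∃ g, ∀ i ∈ J, s i ⬝ᵥ g = w i) := by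
  classical
  have hc' (v : Fin 2 → ZMod 2) : ∃ i : ι, v ≠ 0 → χ i ⬝ᵥ v = 0 ∧ s i ⬝ᵥ v = 1 := by
    by_cases hv : v = 0
    · obtain ⟨i, -⟩ := hc (Pi.single 0 1) (by simp)
      exact ⟨i, fun h => absurd hv h⟩
    · obtain ⟨i, hi⟩ := hc v hv
      exact ⟨i, fun _ => hi⟩
  choose i hi using hc'
  by_cases hZ : ∃ a, χ a = 0 ∧ s a ≠ 0
  · obtain ⟨a, ha, hsa⟩ := hZ
    obtain ⟨p, hp, hsp, hker⟩ : ∃ p, p ≠ 0 ∧ s a ⬝ᵥ p = 0 ∧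
        ∀ v, s a ⬝ᵥ v = 0 → v = 0 ∨ v = p :=
      exists_kernel_two _ hsa
    have hJ : CoversOn χ s {a, i p} := by
      intro v hv
      rcases ZMod.two_cases (s a ⬝ᵥ v) with h | h
      · obtain rfl := (hker v h).resolve_left hv
        exact ⟨i v, by simp, hi v hv⟩
      · exact ⟨a, by simp, by simp [ha], h⟩
    obtain ⟨T, g, hsep, hgJ, hg1, hg0⟩ := exists_separating_extension hs {a, i p}
    by_cases hT : T.card ≤ 1
    · refine ⟨{a, i p} ∪ T, (Finset.card_union_le _ _).trans ?_,
        hJ.mono Finset.subset_union_left, Or.inl hsep⟩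
      have := Finset.card_le_two (a := a) (b := i p)
      omega
    -- Two dual vectors span `𝔽₂²`, so all characters of `J` vanish. Completing `J` would cost four
    -- indices; the holonomy-free quotient of dimension two is used instead.
    · have hχp : χ (i p) = 0 := eq_zero_of_card_ge (linearIndependent_of_dual hg1 hg0)
        (by omega) fun t ht => hgJ t ht _ (by simp)
      refine ⟨{a, i p}, Finset.card_le_two.trans (by norm_num), hJ, Or.inr ⟨?_, fun w => ?_⟩⟩
      · simp [ha, hχp]
      · obtain ⟨g, h1, h2⟩ := exists_dotProduct_eq_two _ hsa p hsp _ (hi p hp).2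
            (w a) (w (i p))
        refine ⟨g, fun j hj => ?_⟩
        rcases Finset.mem_insert.1 hj with rfl | hj
        · exact h1
        · rw [Finset.mem_singleton.1 hj]; exact h2
  · push Not at hZ
    let J := (Finset.univ.filter fun v : Fin 2 → ZMod 2 => v ≠ 0).image i
    have hJ : CoversOn χ s J := fun v hv =>
      ⟨i v, Finset.mem_image_of_mem _ (by simpa using hv), hi v hv⟩
    have hJ0 : ∀ j ∈ J, χ j ≠ 0 := by
      intro j hj h0
      obtain ⟨v, hv, rfl⟩ := Finset.mem_image.1 hj
      have := (hi v (by simpa using hv)).2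
      rw [hZ _ h0, zero_dotProduct] at this
      exact zero_ne_one this
    obtain ⟨T, g, hsep, hgJ, hg1, hg0⟩ := exists_separating_extension hs J
    have hT := card_add_two_le two_pos (linearIndependent_of_dual hg1 hg0) hJ hJ0 hgJ
    have hT0 : T = ∅ := Finset.card_eq_zero.1 (by omega)
    rw [hT0, Finset.union_empty] at hsep
    exact ⟨J, Finset.card_image_le.trans (by decide), hJ, Or.inl hsep⟩

/-- In rank three, a covering set of nonzero characters needs one further index at most. -/
lemma exists_covering_separating_three {χ s : ι → Fin 3 → ZMod 2} (hs : Separates χ)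
    {J : Finset ι} (hJ : CoversOn χ s J) (hJ0 : ∀ j ∈ J, χ j ≠ 0) :
    ∃ J' : Finset ι, J'.card ≤ J.card + 1 ∧ CoversOn χ s J' ∧ SeparatesOn χ J' := by
  classical
  obtain ⟨T, g, hsep, hgJ, hg1, hg0⟩ := exists_separating_extension hs J
  have hT := card_add_two_le three_pos (linearIndependent_of_dual hg1 hg0) hJ hJ0 hgJ
  refine ⟨J ∪ T, (Finset.card_union_le _ _).trans (by omega),
    hJ.mono Finset.subset_union_left, hsep⟩

lemma card_kernel_three : ∀ x : Fin 3 → ZMod 2, x ≠ 0 →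
    (Finset.univ.filter fun v : Fin 3 → ZMod 2 => v ≠ 0 ∧ x ⬝ᵥ v = 0).card = 3 := by
  decide

lemma card_covered_three : ∀ x : Fin 3 → ZMod 2, x ≠ 0 → ∀ y : Fin 3 → ZMod 2,
    (∃ v, x ⬝ᵥ v = 0 ∧ y ⬝ᵥ v = 1) →
    (Finset.univ.filter fun v : Fin 3 → ZMod 2 => x ⬝ᵥ v = 0 ∧ y ⬝ᵥ v = 1).card = 2 := by
  decide

set_option synthInstance.maxHeartbeats 400000 in
set_option synthInstance.maxSize 2000 in
-- Two distinct planes through `g` in `𝔽₂³` meet only in `{0, g}`.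
lemma eq_of_common_kernel_three : ∀ a g : Fin 3 → ZMod 2, a ≠ 0 ∧ g ≠ 0 ∧ a ⬝ᵥ g = 0 →
    ∀ z, z ≠ 0 ∧ z ≠ g ∧ a ⬝ᵥ z = 0 → ∀ b, b ≠ 0 ∧ b ⬝ᵥ g = 0 ∧ b ⬝ᵥ z = 0 → a = b := by
  decide

set_option synthInstance.maxHeartbeats 400000 in
set_option synthInstance.maxSize 2000 in
lemma kernel_three : ∀ a g : Fin 3 → ZMod 2, a ≠ 0 ∧ g ≠ 0 ∧ a ⬝ᵥ g = 0 →
    ∀ v, v ≠ 0 ∧ v ≠ g ∧ a ⬝ᵥ v = 0 → ∀ z, a ⬝ᵥ z = 0 → z = 0 ∨ z = g ∨ z = v ∨ z = v + g := by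
  decide

lemma card_off_plane_three : ∀ g : Fin 3 → ZMod 2, g ≠ 0 → ∀ v, v ≠ 0 → v ≠ g →
    (Finset.univ.filter fun z : Fin 3 → ZMod 2 =>
      z ≠ 0 ∧ z ≠ g ∧ z ≠ v ∧ z ≠ v + g).card = 4 := by
  decide

variable {χ s : ι → Fin 3 → ZMod 2}

/-- The case of rank three in which some index has trivial character. -/
lemma exists_covering_three_of_trivial (hc : Covers χ s) (hs : Separates χ) {a : ι}
    (ha : χ a = 0) (hsa : s a ≠ 0) :
    ∃ J : Finset ι, J.card ≤ 6 ∧ CoversOn χ s J ∧ SeparatesOn χ J := by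
  classical
  have hc' (v : Fin 3 → ZMod 2) : ∃ i : ι, v ≠ 0 → χ i ⬝ᵥ v = 0 ∧ s i ⬝ᵥ v = 1 := by
    by_cases hv : v = 0
    · exact ⟨a, fun h => absurd hv h⟩
    · obtain ⟨i, hi⟩ := hc v hv
      exact ⟨i, fun _ => hi⟩
  choose i hi using hc'
  let Z := Finset.univ.filter fun v : Fin 3 → ZMod 2 => v ≠ 0 ∧ s a ⬝ᵥ v = 0
  have hZ : Z.card = 3 := card_kernel_three _ hsa
  have hmemZ {v : Fin 3 → ZMod 2} : v ∈ Z ↔ v ≠ 0 ∧ s a ⬝ᵥ v = 0 := by simp [Z]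
  let J := insert a (Z.image i)
  have hJc : J.card ≤ 4 := (Finset.card_insert_le _ _).trans (by
    have := Finset.card_image_le (s := Z) (f := i)
    omega)
  have hJ : CoversOn χ s J := by
    intro v hv
    rcases ZMod.two_cases (s a ⬝ᵥ v) with h | h
    · exact ⟨i v, Finset.mem_insert_of_mem (Finset.mem_image_of_mem _ (hmemZ.2 ⟨hv, h⟩)), hi v hv⟩
    · exact ⟨a, Finset.mem_insert_self _ _, by simp [ha], h⟩
  obtain ⟨T, g, hsep, hgJ, hg1, hg0⟩ := exists_separating_extension hs J
  -- If three further indices are needed, their dual vectors form a basis and all characters of `J`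
  -- are trivial. Then `a` and `i p` alone leave at most one vector uncovered, so three indices
  -- cover and three more separate.
  by_cases hT : T.card ≤ 2
  · exact ⟨J ∪ T, (Finset.card_union_le _ _).trans (by omega),
      hJ.mono Finset.subset_union_left, hsep⟩
  obtain ⟨p, hp⟩ : Z.Nonempty := Finset.card_pos.1 (by omega)
  have hpJ : i p ∈ J := Finset.mem_insert_of_mem (Finset.mem_image_of_mem _ hp)
  have hχp : χ (i p) = 0 := eq_zero_of_card_ge (linearIndependent_of_dual hg1 hg0)
    (by omega) fun t ht => hgJ t ht _ hpJ
  obtain ⟨hp0, hap⟩ := hmemZ.1 hp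
  have hpp := (hi p hp0).2
  let Y := Z.filter fun v => s (i p) ⬝ᵥ v = 0
  have hY : Y.card ≤ 1 := by
    have hd : Disjoint Y (Y.image (p + ·)) := by
      rw [Finset.disjoint_left]
      rintro v hv hv'
      obtain ⟨w, hw, rfl⟩ := Finset.mem_image.1 hv'
      have h1 := (Finset.mem_filter.1 hv).2
      have h2 := (Finset.mem_filter.1 hw).2
      rw [dotProduct_add, h2, hpp] at h1
      exact one_ne_zero h1
    have hsub : Y ∪ Y.image (p + ·) ⊆ Z.erase p := by
      intro v hv
      rcases Finset.mem_union.1 hv with hv | hv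
      · obtain ⟨h1, h2⟩ := Finset.mem_filter.1 hv
        refine Finset.mem_erase.2 ⟨?_, h1⟩
        rintro rfl
        exact one_ne_zero (hpp.symm.trans h2)
      · obtain ⟨w, hw, rfl⟩ := Finset.mem_image.1 hv
        obtain ⟨h1, h2⟩ := Finset.mem_filter.1 hw
        obtain ⟨hw0, haw⟩ := hmemZ.1 h1
        refine Finset.mem_erase.2 ⟨by simpa using hw0, hmemZ.2 ⟨fun h => ?_, ?_⟩⟩
        · have := congrArg (s (i p) ⬝ᵥ ·) h
          simp [dotProduct_add, h2, hpp] at this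
        · rw [dotProduct_add, hap, haw, add_zero]
    have := Finset.card_le_card hsub
    rw [Finset.card_union_of_disjoint hd, Finset.card_image_of_injective _ (add_right_injective p),
      Finset.card_erase_of_mem hp] at this
    omega
  let J' := insert a (insert (i p) (Y.image i))
  have hJc' : J'.card ≤ 3 := (Finset.card_insert_le _ _).trans (by
    have h1 := Finset.card_insert_le (i p) (Y.image i)
    have h2 := Finset.card_image_le (s := Y) (f := i)
    omega)
  have hJ' : CoversOn χ s J' := by
    intro v hv
    rcases ZMod.two_cases (s a ⬝ᵥ v) with h | h
    · rcases ZMod.two_cases (s (i p) ⬝ᵥ v) with h' | h'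
      · refine ⟨i v, ?_, hi v hv⟩
        exact Finset.mem_insert_of_mem (Finset.mem_insert_of_mem
          (Finset.mem_image_of_mem _ (Finset.mem_filter.2 ⟨hmemZ.2 ⟨hv, h⟩, h'⟩)))
      · exact ⟨i p, by simp [J'], by simp [hχp], h'⟩
    · exact ⟨a, Finset.mem_insert_self _ _, by simp [ha], h⟩
  obtain ⟨T', g', hsep', hgJ', hg1', hg0'⟩ := exists_separating_extension hs J'
  have hT' := card_le_of_linearIndependent (linearIndependent_of_dual hg1' hg0')
  exact ⟨J' ∪ T', (Finset.card_union_le _ _).trans (by omega),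
    hJ'.mono Finset.subset_union_left, hsep'⟩

set_option maxHeartbeats 800000 in
/-- In rank three, six indices suffice, possibly after adding one coordinate to another with the
same character. -/
lemma exists_covering_three [DecidableEq ι] (hc : Covers χ s) (hs : Separates χ) :
    (∃ J : Finset ι, J.card ≤ 6 ∧ CoversOn χ s J ∧ SeparatesOn χ J) ∨
    ∃ u v, u ≠ v ∧ χ u = χ v ∧ ∃ J : Finset ι, J.card ≤ 6 ∧
      CoversOn χ (Function.update s u (s u + s v)) J ∧ SeparatesOn χ J := by
  by_cases hZ : ∃ a, χ a = 0 ∧ s a ≠ 0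
  · obtain ⟨a, ha, hsa⟩ := hZ
    exact Or.inl (exists_covering_three_of_trivial hc hs ha hsa)
  push Not at hZ
  have hne {i : ι} {v : Fin 3 → ZMod 2} (h : s i ⬝ᵥ v = 1) : χ i ≠ 0 := by
    intro h0
    rw [hZ _ h0, zero_dotProduct] at h
    exact zero_ne_one h
  let A (i : ι) := Finset.univ.filter fun v : Fin 3 → ZMod 2 => χ i ⬝ᵥ v = 0 ∧ s i ⬝ᵥ v = 1
  have hmemA {i : ι} {v : Fin 3 → ZMod 2} : v ∈ A i ↔ χ i ⬝ᵥ v = 0 ∧ s i ⬝ᵥ v = 1 := by simp [A]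
  have hA {i : ι} {v : Fin 3 → ZMod 2} (hv : v ∈ A i) : (A i).card = 2 :=
    card_covered_three _ (hne (hmemA.1 hv).2) _ ⟨v, hmemA.1 hv⟩
  let E : Fin 3 → ZMod 2 := Pi.single 0 1
  have hE : E ≠ 0 := by simp [E]
  obtain ⟨e, he⟩ := hc E hE
  have hAe := hA (hmemA.2 he)
  -- The selection prefers `e` wherever `e` covers, so `e` and the choices at the five other vectors
  -- already contain every `i v`.
  have hc' (v : Fin 3 → ZMod 2) : ∃ i : ι, (v ≠ 0 → v ∈ A i) ∧ (v ∈ A e → i = e) := by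
    by_cases hve : v ∈ A e
    · exact ⟨e, fun _ => hve, fun _ => rfl⟩
    by_cases hv : v = 0
    · exact ⟨e, fun h => absurd hv h, fun _ => rfl⟩
    · obtain ⟨i, hi⟩ := hc v hv
      exact ⟨i, fun _ => hmemA.2 hi, fun h => absurd h hve⟩
  choose i hi hie using hc'
  have hχi {v : Fin 3 → ZMod 2} (hv : v ≠ 0) : χ (i v) ≠ 0 := hne (hmemA.1 (hi v hv)).2
  let N := Finset.univ.filter fun v : Fin 3 → ZMod 2 => v ≠ 0
  have hN : N.card = 7 := by decide
  have hmemN {v : Fin 3 → ZMod 2} : v ∈ N ↔ v ≠ 0 := by simp [N]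
  have hAN (j : ι) : A j ⊆ N := by
    intro v hv
    rw [hmemN]
    rintro rfl
    have := (hmemA.1 hv).2
    rw [dotProduct_zero] at this
    exact zero_ne_one this
  have himage (S : Finset (Fin 3 → ZMod 2)) (hS : S ⊆ N) : ∀ j ∈ S.image i, χ j ≠ 0 := by
    intro j hj
    obtain ⟨v, hv, rfl⟩ := Finset.mem_image.1 hj
    exact hχi (hmemN.1 (hS hv))
  let J := insert e ((N \ A e).image i)
  have hJc : J.card ≤ 6 := by
    refine (Finset.card_insert_le _ _).trans ?_
    have h1 := Finset.card_image_le (s := N \ A e) (f := i)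
    rw [Finset.card_sdiff_of_subset (hAN e), hN, hAe] at h1
    omega
  have hiJ {v : Fin 3 → ZMod 2} (hv : v ≠ 0) : i v ∈ J := by
    by_cases h : v ∈ A e
    · rw [hie v h]; exact Finset.mem_insert_self _ _
    · exact Finset.mem_insert_of_mem (Finset.mem_image_of_mem _
        (Finset.mem_sdiff.2 ⟨hmemN.2 hv, h⟩))
  have hJ : CoversOn χ s J := fun v hv => ⟨i v, hiJ hv, hmemA.1 (hi v hv)⟩
  obtain ⟨T, gT, hsep, hgJ, hg1, hg0⟩ := exists_separating_extension hs J
  rcases T.eq_empty_or_nonempty with rfl | ⟨t, ht⟩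
  · rw [Finset.union_empty] at hsep
    exact Or.inl ⟨J, hJc, hJ, hsep⟩
  obtain ⟨g, hg⟩ : ∃ g, g = gT t := ⟨_, rfl⟩
  have hgne : g ≠ 0 := by
    rintro rfl
    have := hg1 t ht
    rw [← hg, dotProduct_zero] at this
    exact zero_ne_one this
  have hig {v : Fin 3 → ZMod 2} (hv : v ≠ 0) : χ (i v) ⬝ᵥ g = 0 := hg ▸ hgJ t ht _ (hiJ hv)
  -- All selected characters now vanish at `g`. If some `s (i v)` also does, `A (i v)` misses `g`
  -- and is disjoint from `A (i y)`, which lies in another plane through `g`. These two indices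
  -- cover four of the seven vectors, so five cover all and a sixth separates.
  by_cases hB : ∃ v, v ≠ 0 ∧ s (i v) ⬝ᵥ g = 0
  · left
    obtain ⟨v, hv, hvg⟩ := hB
    obtain ⟨y, hy⟩ : ∃ y, χ (i v) ⬝ᵥ y ≠ 0 := by
      by_contra! h
      exact hχi hv (dotProduct_eq_zero _ h)
    have hy0 : y ≠ 0 := by rintro rfl; exact hy (dotProduct_zero _)
    have hd : Disjoint (A (i v)) (A (i y)) := by
      rw [Finset.disjoint_left]
      intro z hz hz'
      have hzg : z ≠ g := by
        rintro rfl
        exact zero_ne_one (hvg.symm.trans (hmemA.1 hz).2)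
      have h := eq_of_common_kernel_three _ g ⟨hχi hv, hgne, hig hv⟩ z
        ⟨hmemN.1 (hAN _ hz), hzg, (hmemA.1 hz).1⟩ _ ⟨hχi hy0, hig hy0, (hmemA.1 hz').1⟩
      exact hy (h ▸ (hmemA.1 (hi y hy0)).1)
    let S := N \ (A (i v) ∪ A (i y))
    have hS : S.card = 3 := by
      rw [Finset.card_sdiff_of_subset (Finset.union_subset (hAN _) (hAN _)),
        Finset.card_union_of_disjoint hd, hN, hA (hi v hv), hA (hi y hy0)]
    obtain ⟨J', hJ'c, hJ', hJ's⟩ := exists_covering_separating_three (s := s) hs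
      (J := insert (i v) (insert (i y) (S.image i))) (by
        intro z hz
        by_cases h1 : z ∈ A (i v)
        · exact ⟨i v, by simp, hmemA.1 h1⟩
        by_cases h2 : z ∈ A (i y)
        · exact ⟨i y, by simp, hmemA.1 h2⟩
        refine ⟨i z, Finset.mem_insert_of_mem (Finset.mem_insert_of_mem
          (Finset.mem_image_of_mem _ (Finset.mem_sdiff.2 ⟨hmemN.2 hz, ?_⟩))), hmemA.1 (hi z hz)⟩
        rw [Finset.mem_union]; tauto) (by
        intro j hj
        rcases Finset.mem_insert.1 hj with rfl | hj
        · exact hχi hv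
        rcases Finset.mem_insert.1 hj with rfl | hj
        · exact hχi hy0
        · exact himage S Finset.sdiff_subset j hj)
    refine ⟨J', hJ'c.trans ?_, hJ', hJ's⟩
    have h1 := Finset.card_insert_le (i v) (insert (i y) (S.image i))
    have h2 := Finset.card_insert_le (i y) (S.image i)
    have h3 := Finset.card_image_le (s := S) (f := i)
    omega
  -- Now every selected index covers `g`, and `i v`, `i (v + g)` have the same plane as kernel. The
  -- sum of their forms `s` is `1` at both `v` and `v + g`, so the merged coordinate covers both;
  -- `g` is left to any of the four indices off the plane.
  · right
    have hsg {v : Fin 3 → ZMod 2} (hv : v ≠ 0) : s (i v) ⬝ᵥ g = 1 :=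
      (ZMod.two_cases _).resolve_left fun h => hB ⟨v, hv, h⟩
    obtain ⟨v, hv, hvg⟩ : ∃ v : Fin 3 → ZMod 2, v ≠ 0 ∧ v ≠ g :=
      (by decide : ∀ g : Fin 3 → ZMod 2, ∃ v : Fin 3 → ZMod 2, v ≠ 0 ∧ v ≠ g) g
    have hv'0 : v + g ≠ 0 := fun h => hvg (CharTwo.add_eq_zero.1 h)
    obtain ⟨hχv, hsv⟩ := hmemA.1 (hi v hv)
    obtain ⟨hχv', hsv'⟩ := hmemA.1 (hi _ hv'0)
    rw [dotProduct_add, hig hv'0, add_zero] at hχv'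
    rw [dotProduct_add, hsg hv'0] at hsv'
    have hsv'0 : s (i (v + g)) ⬝ᵥ v = 0 := by simpa using hsv'
    have hne' : i v ≠ i (v + g) := by
      intro h
      rw [← h, hsv] at hsv'0
      exact one_ne_zero hsv'0
    have hχ : χ (i v) = χ (i (v + g)) := eq_of_common_kernel_three _ g ⟨hχi hv, hgne, hig hv⟩
      v ⟨hv, hvg, hχv⟩ _ ⟨hχi hv'0, hig hv'0, hχv'⟩
    let S := Finset.univ.filter fun z : Fin 3 → ZMod 2 => z ≠ 0 ∧ z ≠ g ∧ z ≠ v ∧ z ≠ v + g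
    have hS : S.card = 4 := card_off_plane_three g hgne v hv hvg
    have hSN : S ⊆ N := fun z hz => hmemN.2 (Finset.mem_filter.1 hz).2.1
    have hSi {z : Fin 3 → ZMod 2} (hz : z ∈ S) : i z ≠ i v := by
      intro h
      have h1 := (Finset.mem_filter.1 hz).2
      have h2 := kernel_three _ g ⟨hχi hv, hgne, hig hv⟩ v ⟨hv, hvg, hχv⟩ z
        (h ▸ (hmemA.1 (hi z h1.1)).1)
      tauto
    refine ⟨i v, i (v + g), hne', hχ, ?_⟩
    obtain ⟨J', hJ'c, hJ', hJ's⟩ := exists_covering_separating_three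
      (s := Function.update s (i v) (s (i v) + s (i (v + g)))) hs
      (J := insert (i v) (S.image i)) (by
        intro z hz
        by_cases hzS : z ∈ S
        · refine ⟨i z, Finset.mem_insert_of_mem (Finset.mem_image_of_mem _ hzS), ?_⟩
          rw [Function.update_of_ne (hSi hzS)]
          exact hmemA.1 (hi z hz)
        by_cases hzg : z = g
        · obtain ⟨w, hw⟩ : S.Nonempty := Finset.card_pos.1 (by omega)
          refine ⟨i w, Finset.mem_insert_of_mem (Finset.mem_image_of_mem _ hw), ?_⟩
          rw [Function.update_of_ne (hSi hw), hzg]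
          exact ⟨hig (hmemN.1 (hSN hw)), hsg (hmemN.1 (hSN hw))⟩
        · refine ⟨i v, Finset.mem_insert_self _ _, ?_⟩
          rw [Function.update_self, add_dotProduct]
          have hz' : z = v ∨ z = v + g := by
            by_contra! h
            exact hzS (Finset.mem_filter.2 ⟨Finset.mem_univ _, hz, hzg, h⟩)
          rcases hz' with rfl | rfl
          · exact ⟨hχv, by rw [hsv, hsv'0, add_zero]⟩
          · refine ⟨by rw [dotProduct_add, hχv, hig hv, add_zero], ?_⟩
            rw [dotProduct_add, dotProduct_add, hsv, hsv'0, hsg hv, hsg hv'0]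
            decide) (by
        intro j hj
        rcases Finset.mem_insert.1 hj with rfl | hj
        · exact hχi hv
        · exact himage S hSN j hj)
    refine ⟨J', hJ'c.trans ?_, hJ', hJ's⟩
    have h1 := Finset.card_insert_le (i v) (S.image i)
    have h2 := Finset.card_image_le (s := S) (f := i)
    omega

end lowRank

/-! ### The bounds assembled -/

lemma diagonalVasquezProperty_of_rank_two :
    DiagonalVasquezProperty (ElementaryTwoGroup 2) 3 := by
  rintro n Γ hB hD ⟨φ⟩
  obtain ⟨π, χ, s, t, hπ, hker, ht, hz, hc, hs⟩ := exists_twists hB hD φ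
  obtain ⟨J, hJ3, hJ, hJs⟩ := exists_covering_two hc hs
  obtain ⟨M, hM, hle, h⟩ := exists_diagonal_quotient hπ ht hz hJ hJs
  exact ⟨M, hM, hker ▸ hle, _, hJ3, h⟩

lemma diagonalVasquezProperty_of_rank_three :
    DiagonalVasquezProperty (ElementaryTwoGroup 3) 6 := by
  rintro n Γ hB hD ⟨φ⟩
  obtain ⟨π, χ, s, t, hπ, hker, ht, hz, hc, hs⟩ := exists_twists hB hD φ
  obtain ⟨J, hJ6, hJ, hJs⟩ | ⟨u, v, huv, hχ, J, hJ6, hJ, hJs⟩ := exists_covering_three hc hs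
  · obtain ⟨M, hM, hle, h⟩ := exists_diagonal_quotient hπ ht hz hJ (Or.inl hJs)
    exact ⟨M, hM, hker ▸ hle, _, hJ6, h⟩
  · obtain ⟨M, hM, hle, h⟩ := exists_diagonal_quotient hπ (IsTwist.update_add ht hχ)
      (exists_lattice_update_add hz huv) hJ (Or.inl hJs)
    exact ⟨M, hM, hker ▸ hle, _, hJ6, h⟩

lemma diagonalVasquezProperty_choose (k : ℕ) :
    DiagonalVasquezProperty (ElementaryTwoGroup k) ((k + 1).choose 2 + 1) := by
  rintro n Γ hB hD ⟨φ⟩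
  obtain ⟨π, χ, s, t, hπ, hker, ht, hz, hc, hs⟩ := exists_twists hB hD φ
  obtain ⟨J, hJc, hJ, hJs⟩ := exists_covering_separating hc hs
  obtain ⟨M, hM, hle, h⟩ := exists_diagonal_quotient hπ ht hz hJ (Or.inl hJs)
  exact ⟨M, hM, hker ▸ hle, _, hJc, h⟩

/-- With `k = j + 4` this compares `k(k+1)/2` with `5·2^(k-3)`; equality holds at `k = 4`. -/
lemma succ_choose_two_le (j : ℕ) : (j + 5).choose 2 ≤ 10 * 2 ^ j := by
  induction j with
  | zero => decide
  | succ j ih =>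
    have h1 : (j + 1 + 5).choose 2 = (j + 5) + (j + 5).choose 2 := by
      rw [show j + 1 + 5 = (j + 5) + 1 by ring, Nat.choose_succ_succ' (j + 5) 1,
        Nat.choose_one_right]
    have h2 : j + 1 ≤ 2 ^ j := Nat.lt_two_pow_self
    rw [h1, pow_succ]
    omega

lemma cast_succ_choose_two (k : ℕ) : (((k + 1).choose 2 : ℕ) : ℝ) = k * (k + 1) / 2 := by
  rw [Nat.cast_choose_two]
  push_cast
  ring

theorem theoremA (k : ℕ) (hk : 2 ≤ k) :
    IsLeast {N : ℕ | DiagonalVasquezProperty (ElementaryTwoGroup k) N}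
      (diagonalVasquez (ElementaryTwoGroup k)) ∧
    (diagonalVasquez (ElementaryTwoGroup k) : ℝ) ≤ 5 * (2 : ℝ) ^ ((k : ℤ) - 3) + 1 ∧
    (Even k →
      (k : ℝ) * ((k : ℝ) + 1) / 2 ≤ (diagonalVasquez (ElementaryTwoGroup k) : ℝ)) ∧
    (Odd k →
      (k : ℝ) * ((k : ℝ) + 1) / 2 - 1 ≤ (diagonalVasquez (ElementaryTwoGroup k) : ℝ)) := by
  have hmem : DiagonalVasquezProperty (ElementaryTwoGroup k)
      (diagonalVasquez (ElementaryTwoGroup k)) :=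
    Nat.sInf_mem (s := {N : ℕ | DiagonalVasquezProperty (ElementaryTwoGroup k) N})
      ⟨_, diagonalVasquezProperty_choose k⟩
  have hle {N : ℕ} (h : DiagonalVasquezProperty (ElementaryTwoGroup k) N) :
      diagonalVasquez (ElementaryTwoGroup k) ≤ N := Nat.sInf_le h
  refine ⟨⟨hmem, fun N h => hle h⟩, ?_⟩
  -- The general bound gives `4 > 7/2` for `k = 2` and `7 > 6` for `k = 3`, so these ranks use their
  -- own lemmas.
  obtain rfl | rfl | hk4 : k = 2 ∨ k = 3 ∨ 4 ≤ k := by omega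
  · have h1 : (diagonalVasquez (ElementaryTwoGroup 2) : ℝ) ≤ 3 := by
      exact_mod_cast hle diagonalVasquezProperty_of_rank_two
    have h2 : (3 : ℝ) ≤ diagonalVasquez (ElementaryTwoGroup 2) := by
      exact_mod_cast three_le_of_diagonalVasquezProperty hmem
    refine ⟨h1.trans (by norm_num), fun _ => le_trans (by norm_num) h2,
      fun h => absurd h (by decide)⟩
  · have h1 : (diagonalVasquez (ElementaryTwoGroup 3) : ℝ) ≤ 6 := by
      exact_mod_cast hle diagonalVasquezProperty_of_rank_three
    have h2 : (5 : ℝ) ≤ diagonalVasquez (ElementaryTwoGroup 3) := by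
      exact_mod_cast five_le_of_diagonalVasquezProperty hmem
    refine ⟨h1.trans (by norm_num), fun h => absurd h (by decide),
      fun _ => le_trans (by norm_num) h2⟩
  · have h1 : (diagonalVasquez (ElementaryTwoGroup k) : ℝ) ≤ (k + 1).choose 2 + 1 := by
      exact_mod_cast hle (diagonalVasquezProperty_choose k)
    have h2 : (((k + 1).choose 2 : ℕ) : ℝ) ≤ diagonalVasquez (ElementaryTwoGroup k) := by
      exact_mod_cast choose_le_of_diagonalVasquezProperty hk4 hmem
    have h3 := cast_succ_choose_two k
    refine ⟨h1.trans (add_le_add_left ?_ 1), fun _ => by linarith, fun _ => by linarith⟩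
    obtain ⟨j, rfl⟩ := Nat.exists_eq_add_of_le hk4
    have h4 : (5 : ℝ) * 2 ^ (((4 + j : ℕ) : ℤ) - 3) = ((10 * 2 ^ j : ℕ) : ℝ) := by
      rw [show ((4 + j : ℕ) : ℤ) - 3 = ((j + 1 : ℕ) : ℤ) by push_cast; ring, zpow_natCast, pow_succ]
      push_cast
      ring
    rw [h4, show 4 + j + 1 = j + 5 by ring]
    exact_mod_cast succ_choose_two_le j
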